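/- Let $H=(H_{nm})_{n,m\in\mathbb Z}$ and $K=(K_{nm})_{n,m\in\mathbb Z}$ be real band matrices of constant finite width: there are integers $p_1\le p_2$, $q_1\le q_2$ such that $H_{n,n+\sigma}=h_\sigma(n)$ for $p_1\le\sigma\le p_2$ and $H_{n,n+\sigma}=0$ otherwise, $K_{m+\sigma,m}=k_\sigma(m)$ for $q_1\le\sigma\le q_2$ and $K_{m+\sigma,m}=0$ otherwise, with $h_{p_1}(n),h_{p_2}(n),k_{q_1}(m),k_{q_2}(m)\neq0$ for all $n,m\in\mathbb Z$. Consider the infinite generalized Toda system $$u_{n,xy}=F_n,\qquad F_n=\sum_m K_{nm}\exp\Big(\sum_l H_{ml}u_l\Big),\qquad n\in\mathbb Z .$$ *Setting.* Consider vector fields $v=\xi\,\partial_x+\eta\,\partial_y+\sum_n\phi_n\,\partial_{u_n}$ whose coefficients are real functions of $x,y\in\mathbb R$ and of the finitely supported sequences $\{u_k\}_{k\in\mathbb Z}$, $C^\infty$ in $x$, $y$ and any finite number of the $u_k$. (Thus formal sums $\sum_n\phi_n\partial_{u_n}$ and linear forms $\sum_m c_mu_m$ with infinitely many nonzero coefficients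 are allowed.) Such a $v$ is a *point symmetry* if its second prolongation satisfies $\mathrm{pr}^{(2)}v\,(u_{n,xy}-F_n)=0$ for all $n$ on the set of 2-jets (with $u_{k},u_{k,x},u_{k,y},u_{k,xx},u_{k,yy}$ finitely supported in $k$) where $u_{k,xy}=F_k$ for all $k$; here the terms $\sum_k f_{u_k}u_{k,xy}=\sum_k f_{u_k}F_k$ of the total derivatives $D_xD_yf$, $f\in\{\phi_n,\xi,\eta\}$, are collected by exponentials, i.e. become series $\sum_m\big(\sum_k f_{u_k}K_{km}\big)\exp\big(\sum_l H_{ml}u_l\big)$ with finite inner sums, and the resulting series over $m$ in $\mathrm{pr}^{(2)}v\,(u_{n,xy}-F_n)$ is required to converge (unconditionally). **Theorem.** The equations $\sum_{\sigma=p_1}^{p_2}h_\sigma(n)\psi_{\sigma+n}=0$ and $\sum_{\sigma=q_1}^{q_2}k_\sigma(m)\phi_{\sigma+m}=0$ have solution spaces of dimension $p_2-p_1$ and $q_2-q_1$, and the equation $\sum_{\sigma=p_1}^{p_2}h_\sigma(n)b_{\sigma+n}=1$ has a solution. The point symmetries of the system form an infinite-dimensional real vector space, closed under commutators in the sense that if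 all series occurring in the commutator of two point symmetries converge (unconditionally) and define a vector field with smooth coefficients, then this vector field is a point symmetry. Let $\psi^1,\dots,\psi^{p_2-p_1}$ and $\phi^1,\dots,\phi^{q_2-q_1}$ be any bases of the two solution spaces and $b$ any solution of the inhomogeneous equation. Then $$\hat X(\xi)=\xi(x)\partial_x-\xi_x(x)\sum_n b_n\partial_{u_n},\qquad \hat Y(\eta)=\eta(y)\partial_y-\eta_y(y)\sum_n b_n\partial_{u_n},$$ $$\hat U_j(r_j)=r_j(x)\sum_n\psi^j_n\partial_{u_n},\qquad \hat V_j(s_j)=s_j(y)\sum_n\psi^j_n\partial_{u_n},\qquad \hat Z_{jl}=\Big(\sum_m\phi^l_mu_m\Big)\sum_n\psi^j_n\partial_{u_n}$$ $(1\le j\le p_2-p_1,\ 1\le l\le q_2-q_1)$ are point symmetries for arbitrary $C^\infty$ functions $\xi,\eta,r_j,s_j:\mathbb R\to\mathbb R$, and every point symmetry is of the form $$\hat X(\xi)+\hat Y(\eta)+\sum_j\hat U_j(r_j)+\sum_j\hat V_j(s_j)+\sum_{j,l}q_{jl}\hat Z_{jl}$$ with $C^\infty$ functions $\xi,\eta,r_j,s_j$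 and constants $q_{jl}\in\mathbb R$. Here $\xi,\eta,q_{jl}$ are uniquely determined, and $r_j,s_j$ are unique up to the obvious relation $\hat U_j(1)=\hat V_j(1)$, i.e. up to replacing $(r_j,s_j)$ by $(r_j+c_j,s_j-c_j)$ with constants $c_j$. -/

import Mathlib

open scoped ContDiff

namespace GenToda

noncomputable section

/-! ### Band matrices and their difference equations -/

/-- `M` is a band matrix with constant band `[a, b]`: `M n (n + σ)` vanishes for `σ ∉ [a, b]`, and the
two outermost diagonals `σ = a` and `σ = b` vanish nowhere. -/
def IsBand (M : Matrix ℤ ℤ ℝ) (a b : ℤ) : Prop :=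
  a ≤ b ∧ (∀ n σ : ℤ, σ ∉ Finset.Icc a b → M n (n + σ) = 0) ∧
    ∀ n : ℤ, M n (n + a) ≠ 0 ∧ M n (n + b) ≠ 0

/-- The difference operator `f ↦ (n ↦ ∑_{σ = a}^{b} M n (n + σ) f (n + σ))` on all real sequences. -/
def diffOp (M : Matrix ℤ ℤ ℝ) (a b : ℤ) : (ℤ → ℝ) →ₗ[ℝ] (ℤ → ℝ) where
  toFun f n := ∑ σ ∈ Finset.Icc a b, M n (n + σ) * f (n + σ)
  map_add' f g := by
    funext n
    simp [mul_add, Finset.sum_add_distrib]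
  map_smul' c f := by
    funext n
    simp only [Pi.smul_apply, smul_eq_mul, RingHom.id_apply, Finset.mul_sum]
    exact Finset.sum_congr rfl fun σ _ => by ring

/-! ### Functions of `x`, `y` and the infinitely many fields `u_k` -/

/-- Functions `f(x, y, {u_k})`.  The sequence `{u_k}` ranges over the finitely supported ones, so that
a linear form `∑_m c_m u_m` with arbitrary real coefficients `c_m`, `m ∈ ℤ`, is such a function. -/
abbrev Fn : Type := ℝ → ℝ → (ℤ →₀ ℝ) → ℝ

/-- `f` is smooth in `x`, `y` and any finite number of the variables `u_k`. -/
def IsSmooth (f : Fn) : Prop :=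
  ∀ I : Finset ℤ, ContDiff ℝ ∞ fun p : ℝ × ℝ × (I → ℝ) =>
    f p.1 p.2.1 (∑ k : I, Finsupp.single (k : ℤ) (p.2.2 k))

/-- `∂f/∂x`. -/
def dX (f : Fn) : Fn := fun x y u => deriv (fun t => f t y u) x

/-- `∂f/∂y`. -/
def dY (f : Fn) : Fn := fun x y u => deriv (fun t => f x t u) y

/-- `∂f/∂u_k`. -/
def dU (k : ℤ) (f : Fn) : Fn := fun x y u => deriv (fun t => f x y (u + Finsupp.single k t)) 0

/-! ### The field equations `u_{n,xy} = F_n` -/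

/-- The exponential `exp (∑_l H_{ml} u_l)`. -/
def expTerm (H : Matrix ℤ ℤ ℝ) (m : ℤ) : Fn :=
  fun _ _ u => Real.exp (u.sum fun l a => H m l * a)

/-- The right-hand side `F_n = ∑_m K_{nm} exp (∑_l H_{ml} u_l)`; each row of a band matrix `K` is finite. -/
def force (H K : Matrix ℤ ℤ ℝ) (n : ℤ) : Fn :=
  fun x y u => ∑ᶠ m : ℤ, K n m * expTerm H m x y u

/-! ### Vector fields `ξ ∂_x + η ∂_y + ∑_n φ_n ∂_{u_n}` and their prolongation -/

/-- Coefficients `(ξ, η, (φ_n)_n)` of a vector field `ξ ∂_x + η ∂_y + ∑_n φ_n ∂_{u_n}`. -/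
abbrev VField : Type := Fn × Fn × (ℤ → Fn)

/-- The coefficient `ξ` of `∂_x`. -/
abbrev VField.cx (v : VField) : Fn := v.1

/-- The coefficient `η` of `∂_y`. -/
abbrev VField.cy (v : VField) : Fn := v.2.1

/-- The coefficient `φ_n` of `∂_{u_n}`. -/
abbrev VField.cu (v : VField) (n : ℤ) : Fn := v.2.2 n

/-- All coefficients are smooth. -/
def VField.Smooth (v : VField) : Prop :=
  IsSmooth v.cx ∧ IsSmooth v.cy ∧ ∀ n, IsSmooth (v.cu n)

/-- A point of the second jet space over the solution manifold: `x, y, u_k, u_{k,x}, u_{k,y}, u_{k,xx},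
u_{k,yy}` are free coordinates, while `u_{k,xy} = F_k(u)` is given by the field equations. -/
structure Jet where
  x : ℝ
  y : ℝ
  u : ℤ →₀ ℝ
  ux : ℤ →₀ ℝ
  uy : ℤ →₀ ℝ
  uxx : ℤ →₀ ℝ
  uyy : ℤ →₀ ℝ

/-- The total derivative `D_x f = f_x + ∑_k u_{k,x} f_{u_k}`. -/
def totX (f : Fn) (j : Jet) : ℝ :=
  dX f j.x j.y j.u + j.ux.sum fun k a => a * dU k f j.x j.y j.u

/-- The total derivative `D_y f = f_y + ∑_k u_{k,y} f_{u_k}`. -/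
def totY (f : Fn) (j : Jet) : ℝ :=
  dY f j.x j.y j.u + j.uy.sum fun k a => a * dU k f j.x j.y j.u

/-- The part of `D_x D_y f` without the mixed derivatives `u_{k,xy}`:
`f_{xy} + ∑_k u_{k,x} f_{y u_k} + ∑_k u_{k,y} f_{x u_k} + ∑_{k,l} u_{k,x} u_{l,y} f_{u_k u_l}`. -/
def totXYfree (f : Fn) (j : Jet) : ℝ :=
  dX (dY f) j.x j.y j.u
    + (j.ux.sum fun k a => a * dU k (dY f) j.x j.y j.u)
    + (j.uy.sum fun k a => a * dU k (dX f) j.x j.y j.u)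
    + (j.ux.sum fun k a => j.uy.sum fun l c => a * c * dU k (dU l f) j.x j.y j.u)

/-- The remaining part of `D_x D_y f` is `∑_k f_{u_k} u_{k,xy}`, which becomes
`∑_k f_{u_k} ∑_m K_{km} exp (∑_l H_{ml} u_l)` on solutions.  Collected by exponentials, this is a series
over `m`, whose `m`-th term is `(∑_k f_{u_k} K_{km}) exp (∑_l H_{ml} u_l)` with a finite inner sum. -/
def totXYexp (H K : Matrix ℤ ℤ ℝ) (f : Fn) (j : Jet) (m : ℤ) : ℝ :=
  (∑ᶠ k : ℤ, dU k f j.x j.y j.u * K k m) * expTerm H m j.x j.y j.u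

/-- The second prolongation of `v`, applied to `E_n = u_{n,xy} - F_n` and restricted to the solution
manifold, is
`pr v E_n = D_x D_y φ_n - u_{n,x} D_x D_y ξ - u_{n,y} D_x D_y η - u_{n,xy} (D_x ξ + D_y η)
  - u_{n,xx} D_y ξ - u_{n,yy} D_x η - ∑_α φ_α ∂F_n/∂u_α`.
This is its part outside the series over the exponentials (the sum over `α` is finite). -/
def prolongFree (H K : Matrix ℤ ℤ ℝ) (v : VField) (n : ℤ) (j : Jet) : ℝ :=
  totXYfree (v.cu n) j - j.ux n * totXYfree v.cx j - j.uy n * totXYfree v.cy j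
    - force H K n j.x j.y j.u * (totX v.cx j + totY v.cy j)
    - j.uxx n * totY v.cx j - j.uyy n * totX v.cy j
    - ∑ᶠ α : ℤ, v.cu α j.x j.y j.u * dU α (force H K n) j.x j.y j.u

/-- The `m`-th term of the part of `pr v E_n` that is a series over the exponentials. -/
def prolongExp (H K : Matrix ℤ ℤ ℝ) (v : VField) (n : ℤ) (j : Jet) (m : ℤ) : ℝ :=
  totXYexp H K (v.cu n) j m - j.ux n * totXYexp H K v.cx j m - j.uy n * totXYexp H K v.cy j m

/-- `v` generates Lie point symmetries: its coefficients are smooth and `pr v E_n` vanishes for all `n`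
at every point of the second jet space at which the field equations `E_k = 0` hold for all `k`. -/
def IsPointSymmetry (H K : Matrix ℤ ℤ ℝ) (v : VField) : Prop :=
  v.Smooth ∧ ∀ (n : ℤ) (j : Jet), HasSum (prolongExp H K v n j) (-prolongFree H K v n j)

/-- If `f` and `g` are corresponding coefficients of `v` and `w`, then `c = v(g) - w(f)` is the
corresponding coefficient of the commutator: the series over `k` converges, with the right sum. -/
def IsBracketCoeff (v w : VField) (f g c : Fn) : Prop :=
  ∀ x y u, HasSum (fun k : ℤ => v.cu k x y u * dU k g x y u - w.cu k x y u * dU k f x y u)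
    (c x y u - (v.cx x y u * dX g x y u + v.cy x y u * dY g x y u
      - w.cx x y u * dX f x y u - w.cy x y u * dY f x y u))

/-- The commutator of `v` and `w` is defined (all series in it converge) and equal to `z`. -/
def IsBracket (v w z : VField) : Prop :=
  IsBracketCoeff v w v.cx w.cx z.cx ∧ IsBracketCoeff v w v.cy w.cy z.cy ∧
    ∀ n, IsBracketCoeff v w (v.cu n) (w.cu n) (z.cu n)

/-! ### The generators -/

/-- `X(ξ) = ξ(x) ∂_x - ξ_x(x) ∑_n b_n ∂_{u_n}`. -/
def fieldX (b : ℤ → ℝ) (ξ : ℝ → ℝ) : VField :=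
  (fun x _ _ => ξ x, 0, fun n x _ _ => -(deriv ξ x * b n))

/-- `Y(η) = η(y) ∂_y - η_y(y) ∑_n b_n ∂_{u_n}`. -/
def fieldY (b : ℤ → ℝ) (η : ℝ → ℝ) : VField :=
  (0, fun _ y _ => η y, fun n _ y _ => -(deriv η y * b n))

/-- `U(r) = r(x) ∑_n ψ_n ∂_{u_n}`. -/
def fieldU (ψ : ℤ → ℝ) (r : ℝ → ℝ) : VField :=
  (0, 0, fun n x _ _ => r x * ψ n)

/-- `V(s) = s(y) ∑_n ψ_n ∂_{u_n}`. -/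
def fieldV (ψ : ℤ → ℝ) (s : ℝ → ℝ) : VField :=
  (0, 0, fun n _ y _ => s y * ψ n)

/-- `Z = (∑_m φ_m u_m) ∑_n ψ_n ∂_{u_n}`. -/
def fieldZ (φ ψ : ℤ → ℝ) : VField :=
  (0, 0, fun n _ _ u => (u.sum fun m a => φ m * a) * ψ n)

/-- `X(ξ) + Y(η) + ∑_j U_j(r_j) + ∑_j V_j(s_j) + ∑_{j,l} q_{jl} Z_{jl}`. -/
def combination {d e : ℕ} (b : ℤ → ℝ) (ψ : Fin d → ℤ → ℝ) (φ : Fin e → ℤ → ℝ)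
    (ξ η : ℝ → ℝ) (r s : Fin d → ℝ → ℝ) (q : Fin d → Fin e → ℝ) : VField :=
  fieldX b ξ + fieldY b η + ∑ j, fieldU (ψ j) (r j) + ∑ j, fieldV (ψ j) (s j)
    + ∑ j, ∑ l, q j l • fieldZ (φ l) (ψ j)

end

end GenToda

namespace GenToda

noncomputable section

/-! Since the outermost diagonals of a band matrix vanish nowhere, its difference equation can be
solved recursively in both directions from the values on a window of length `b - a`. This gives the
dimensions, a solution `b` of the inhomogeneous equation, and the smoothness of coordinates of
kernel-valued curves.

The prolongation condition is compared at jets that differ in few derivative coordinates. The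
coefficients of `u_{xx}` and `u_{yy}` force `ξ = ξ(x)` and `η = η(y)`; those of `u_x`, `u_y` and
`u_x u_y` then force `φ_n = g_n(x, y) + ∑_k A_{nk} u_k` with a constant matrix `A`
(`IsPointSymmetry.exists_affineField`).

For such affine fields the condition is an identity between an infinite series of exponentials and a
finite sum of exponentials with affine coefficients. Its coefficients can be compared
(`IsBand.coeff_eq_of_hasSum_exp`): along a suitable line through `0`, all but finitely many
exponents are `0`, and subtracting the value at `0` leaves a finite sum in which the chosen exponent
is isolated. The outcome is `HA = 0` and `(AK)_{nm} = K_{nm} s_m` with `s_m = ξ' + η' + (Hg)_m`.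
Applying `H` to the second relation shows that `s_m` times the `m`-th column of `K` is a finitely
supported element of `ker H`, so `s_m = 0` and `AK = 0`. What remains is `g_{xy} = 0`.

These conditions (`IsSymmetryData`, `isPointSymmetry_iff`) are linear, which gives the vector space.
Expanding `g` and `A` in bases of the kernels gives the generators, and the conditions survive the
convergent series of a commutator because the difference operators are finite sums. -/

/-! ### Solving the difference equation of a band matrix -/

theorem IsBand.eq_zero_of_notMem {M : Matrix ℤ ℤ ℝ} {a b : ℤ} (hM : IsBand M a b) {n k : ℤ}
    (h : k ∉ Finset.Icc (n + a) (n + b)) : M n k = 0 := by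
  have := hM.2.1 n (k - n) (by simp only [Finset.mem_Icc] at h ⊢; omega)
  simpa using this

theorem IsBand.mem_of_ne_zero {M : Matrix ℤ ℤ ℝ} {a b : ℤ} (hM : IsBand M a b) {n k : ℤ}
    (h : M n k ≠ 0) : n + a ≤ k ∧ k ≤ n + b := by
  by_contra h'
  exact h (hM.eq_zero_of_notMem (by simpa only [Finset.mem_Icc] using h'))

theorem diffOp_eq_sum_Icc (M : Matrix ℤ ℤ ℝ) (a b : ℤ) (f : ℤ → ℝ) (n : ℤ) :
    diffOp M a b f n = ∑ k ∈ Finset.Icc (n + a) (n + b), M n k * f k := by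
  change ∑ σ ∈ Finset.Icc a b, M n (n + σ) * f (n + σ) = _
  refine Finset.sum_bij (fun σ _ => n + σ) ?_ ?_ ?_ ?_
  · intro σ hσ
    simp only [Finset.mem_Icc] at hσ ⊢
    omega
  · intro σ _ τ _ h
    simpa using h
  · intro k hk
    simp only [Finset.mem_Icc] at hk
    exact ⟨k - n, by simp only [Finset.mem_Icc]; omega, by ring⟩
  · intro σ _
    rfl

theorem IsBand.finsum_eq_diffOp {M : Matrix ℤ ℤ ℝ} {a b : ℤ} (hM : IsBand M a b) (f : ℤ → ℝ)
    (n : ℤ) : ∑ᶠ k, f k * M n k = diffOp M a b f n := by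
  rw [diffOp_eq_sum_Icc, finsum_eq_sum_of_support_subset (s := Finset.Icc (n + a) (n + b))]
  · exact Finset.sum_congr rfl fun k _ => mul_comm _ _
  · intro k hk
    rw [Function.mem_support] at hk
    have := hM.mem_of_ne_zero (right_ne_zero_of_mul hk)
    simpa using this

/-- The two-sided recursion solving `diffOp M a b f = c` from the values of `f` on `[a, b)`. -/
def bandSolution (M : Matrix ℤ ℤ ℝ) (a b : ℤ) (hab : a ≤ b) (c f₀ : ℤ → ℝ) (j : ℤ) : ℝ :=
  if _hb : b ≤ j then
    (c (j - b) - ∑ i ∈ (Finset.Ico (j - b + a) j).attach,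
      M (j - b) i.1 * bandSolution M a b hab c f₀ i.1) / M (j - b) j
  else if _ha : j < a then
    (c (j - a) - ∑ i ∈ (Finset.Ioc j (j - a + b)).attach,
      M (j - a) i.1 * bandSolution M a b hab c f₀ i.1) / M (j - a) j
  else f₀ j
-- The distance from `j` to the window `[a, b)`: each value uses only indices that are strictly
-- closer to the window or in it.
termination_by (j - b + 1).toNat + (a - j).toNat
decreasing_by
  · have := Finset.mem_Ico.1 i.2
    omega
  · have := Finset.mem_Ioc.1 i.2
    omega

theorem bandSolution_eq_init (M : Matrix ℤ ℤ ℝ) {a b : ℤ} (hab : a ≤ b) (c f₀ : ℤ → ℝ) {j : ℤ}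
    (h₁ : a ≤ j) (h₂ : j < b) : bandSolution M a b hab c f₀ j = f₀ j := by
  rw [bandSolution, dif_neg (by omega), dif_neg (by omega)]

/-- Every equation is used by exactly one step of the recursion: equation `n ≥ 0` defines the value
at `n + b`, equation `n < 0` the value at `n + a`. -/
theorem IsBand.diffOp_bandSolution {M : Matrix ℤ ℤ ℝ} {a b : ℤ} (hM : IsBand M a b)
    (c f₀ : ℤ → ℝ) : diffOp M a b (bandSolution M a b hM.1 c f₀) = c := by
  funext n
  have hab := hM.1
  rw [diffOp_eq_sum_Icc]
  rcases le_or_gt 0 n with hn | hn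
  · have hI : Finset.Icc (n + a) (n + b) = insert (n + b) (Finset.Ico (n + a) (n + b)) := by
      ext; simp only [Finset.mem_Icc, Finset.mem_insert, Finset.mem_Ico]; omega
    have h := bandSolution.eq_1 M a b hab c f₀ (n + b)
    rw [dif_pos (by omega)] at h
    simp only [add_sub_cancel_right] at h
    rw [Finset.sum_attach _ fun i => M n i * bandSolution M a b hab c f₀ i] at h
    rw [hI, Finset.sum_insert (by simp), h, mul_div_cancel₀ _ (hM.2.2 n).2, add_sub_cancel_right, sub_add_cancel]
  · have hI : Finset.Icc (n + a) (n + b) = insert (n + a) (Finset.Ioc (n + a) (n + b)) := by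
      ext; simp only [Finset.mem_Icc, Finset.mem_insert, Finset.mem_Ioc]; omega
    have h := bandSolution.eq_1 M a b hab c f₀ (n + a)
    rw [dif_neg (by omega), dif_pos (by omega)] at h
    simp only [add_sub_cancel_right] at h
    rw [Finset.sum_attach _ fun i => M n i * bandSolution M a b hab c f₀ i] at h
    rw [hI, Finset.sum_insert (by simp), h, mul_div_cancel₀ _ (hM.2.2 n).1, add_sub_cancel_right, sub_add_cancel]

/-- Strong induction on the distance to the window; the equation used at `j` has `j` as its
outermost index, with nonzero coefficient. -/
theorem IsBand.eq_zero_of_window {M : Matrix ℤ ℤ ℝ} {a b : ℤ} (hM : IsBand M a b) {f : ℤ → ℝ}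
    (hf : diffOp M a b f = 0) (hw : ∀ j, a ≤ j → j < b → f j = 0) : f = 0 := by
  have key : ∀ (N : ℕ) (j : ℤ), (j - b + 1).toNat + (a - j).toNat = N → f j = 0 := by
    intro N
    induction N using Nat.strong_induction_on with
    | _ N ih =>
      intro j hj
      have hab := hM.1
      have ih' : ∀ i : ℤ, (i - b + 1).toNat + (a - i).toNat < N → f i = 0 :=
        fun i hi => ih _ hi i rfl
      by_cases hb : b ≤ j
      · have h := congrFun hf (j - b)
        rw [diffOp_eq_sum_Icc, Finset.sum_eq_single j] at h
        · have h0 := (hM.2.2 (j - b)).2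
          rw [sub_add_cancel] at h0
          exact (mul_eq_zero.1 h).resolve_left h0
        · intro i hi hij
          rw [Finset.mem_Icc] at hi
          rw [ih' i (by omega), mul_zero]
        · intro hj'
          exact absurd (Finset.mem_Icc.2 (by omega)) hj'
      · by_cases ha : j < a
        · have h := congrFun hf (j - a)
          rw [diffOp_eq_sum_Icc, Finset.sum_eq_single j] at h
          · have h0 := (hM.2.2 (j - a)).1
            rw [sub_add_cancel] at h0
            exact (mul_eq_zero.1 h).resolve_left h0
          · intro i hi hij
            rw [Finset.mem_Icc] at hi
            rw [ih' i (by omega), mul_zero]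
          · intro hj'
            exact absurd (Finset.mem_Icc.2 (by omega)) hj'
        · exact hw j (by omega) (by omega)
  funext j
  exact key _ j rfl

/-- A solution of the homogeneous equation is determined by its values on `[a, b)`. -/
def windowMap (M : Matrix ℤ ℤ ℝ) (a b : ℤ) :
    LinearMap.ker (diffOp M a b) →ₗ[ℝ] (Fin (b - a).toNat → ℝ) where
  toFun f i := f.1 (a + (i : ℕ))
  map_add' _ _ := rfl
  map_smul' _ _ := rfl

theorem IsBand.windowMap_bijective {M : Matrix ℤ ℤ ℝ} {a b : ℤ} (hM : IsBand M a b) :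
    Function.Bijective (windowMap M a b) := by
  constructor
  · rw [← LinearMap.ker_eq_bot, LinearMap.ker_eq_bot']
    intro f hf
    refine Subtype.ext (hM.eq_zero_of_window f.2 fun j h₁ h₂ => ?_)
    have h := congrFun hf ⟨(j - a).toNat, by omega⟩
    have hj : a + (((j - a).toNat : ℕ) : ℤ) = j := by omega
    change f.1 (a + (((j - a).toNat : ℕ) : ℤ)) = 0 at h
    rwa [hj] at h
  · intro g
    -- Only the values of `f₀` on `[a, b)` are ever read.
    let f₀ : ℤ → ℝ := fun j => if h : (j - a).toNat < (b - a).toNat then g ⟨_, h⟩ else 0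
    refine ⟨⟨bandSolution M a b hM.1 0 f₀, hM.diffOp_bandSolution 0 f₀⟩, ?_⟩
    funext i
    change bandSolution M a b hM.1 0 f₀ (a + (i : ℕ)) = g i
    rw [bandSolution_eq_init M hM.1 _ _ (by omega) (by omega)]
    have h : (a + ((i : ℕ) : ℤ) - a).toNat = i := by omega
    simp only [f₀, h, i.isLt, dite_true]

/-- The values on `[a, b)` parametrize the solutions of the homogeneous equation. -/
def IsBand.windowEquiv {M : Matrix ℤ ℤ ℝ} {a b : ℤ} (hM : IsBand M a b) :
    LinearMap.ker (diffOp M a b) ≃ₗ[ℝ] (Fin (b - a).toNat → ℝ) :=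
  LinearEquiv.ofBijective (windowMap M a b) hM.windowMap_bijective

/-- A functional on the kernel is a linear function of finitely many window values, hence
continuous. This makes the coefficient functions `r_j`, `s_j` smooth. -/
theorem IsBand.contDiff_of_ker {M : Matrix ℤ ℤ ℝ} {a b : ℤ} (hM : IsBand M a b)
    (g : ℝ → LinearMap.ker (diffOp M a b)) (hg : ∀ n, ContDiff ℝ ∞ fun t => (g t).1 n)
    (L : LinearMap.ker (diffOp M a b) →ₗ[ℝ] ℝ) : ContDiff ℝ ∞ fun t => L (g t) := by
  have h : (fun t => L (g t)) = fun t =>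
      LinearMap.toContinuousLinearMap (L ∘ₗ hM.windowEquiv.symm.toLinearMap)
        (fun i : Fin (b - a).toNat => (g t).1 (a + (i : ℕ))) := by
    funext t
    change L (g t) = L (hM.windowEquiv.symm (hM.windowEquiv (g t)))
    rw [LinearEquiv.symm_apply_apply]
  rw [h]
  exact (ContinuousLinearMap.contDiff _).comp (contDiff_pi.2 fun i => hg _)

/-! ### Linear forms on finitely supported sequences -/

/-- The linear form `u ↦ ∑_m c_m u_m` on finitely supported sequences. -/
def linForm (c : ℤ → ℝ) : (ℤ →₀ ℝ) →ₗ[ℝ] ℝ :=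
  Finsupp.lsum ℝ fun l => c l • LinearMap.id

theorem linForm_apply (c : ℤ → ℝ) (u : ℤ →₀ ℝ) : linForm c u = u.sum fun l a => c l * a := by
  rw [linForm, Finsupp.lsum_apply]
  rfl

@[simp]
theorem linForm_single (c : ℤ → ℝ) (k : ℤ) (a : ℝ) :
    linForm c (Finsupp.single k a) = c k * a := by
  simp [linForm]

theorem linForm_eq_sum (c : ℤ → ℝ) {u : ℤ →₀ ℝ} {s : Finset ℤ} (h : u.support ⊆ s) :
    linForm c u = ∑ l ∈ s, u l * c l := by
  rw [linForm_apply, Finsupp.sum_of_support_subset u h _ (by simp)]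
  exact Finset.sum_congr rfl fun l _ => mul_comm _ _

theorem linForm_add_left (c d : ℤ → ℝ) (u : ℤ →₀ ℝ) :
    linForm (c + d) u = linForm c u + linForm d u := by
  simp [linForm_eq_sum _ subset_rfl, mul_add, Finset.sum_add_distrib]

theorem linForm_smul_left (r : ℝ) (c : ℤ → ℝ) (u : ℤ →₀ ℝ) :
    linForm (r • c) u = r * linForm c u := by
  simp only [linForm_eq_sum _ subset_rfl, Finset.mul_sum, Pi.smul_apply, smul_eq_mul]
  exact Finset.sum_congr rfl fun l _ => by ring

@[simp]
theorem linForm_zero_left (u : ℤ →₀ ℝ) : linForm 0 u = 0 := by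
  simp [linForm_eq_sum _ subset_rfl]

/-! ### Smooth functions of infinitely many variables -/

theorem IsSmooth.comp_linear {f : Fn} (hf : IsSmooth f) {E : Type*} [NormedAddCommGroup E]
    [NormedSpace ℝ E] [FiniteDimensional ℝ E] (L : E →ₗ[ℝ] (ℤ →₀ ℝ)) (I : Finset ℤ)
    (hL : ∀ e, (L e).support ⊆ I) :
    ContDiff ℝ ∞ fun p : ℝ × ℝ × E => f p.1 p.2.1 (L p.2.2) := by
  have h : (fun p : ℝ × ℝ × E => f p.1 p.2.1 (L p.2.2)) =
      (fun p : ℝ × ℝ × (I → ℝ) =>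
        f p.1 p.2.1 (∑ k : I, Finsupp.single (k : ℤ) (p.2.2 k))) ∘
      fun p : ℝ × ℝ × E => (p.1, p.2.1, fun k : I =>
        LinearMap.toContinuousLinearMap (Finsupp.lapply (k : ℤ) ∘ₗ L) p.2.2) := by
    funext p
    have : ∑ k : I, Finsupp.single (k : ℤ) (L p.2.2 k) = L p.2.2 := by
      rw [Finset.sum_coe_sort I fun k => Finsupp.single k (L p.2.2 k)]
      conv_rhs => rw [← Finsupp.sum_single (L p.2.2)]
      exact (Finsupp.sum_of_support_subset _ (hL _) _ (by simp)).symm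
    simp only [Function.comp_apply, LinearMap.coe_toContinuousLinearMap', LinearMap.comp_apply,
      Finsupp.lapply_apply, this]
  rw [h]
  refine (hf I).comp (contDiff_fst.prodMk (contDiff_snd.fst.prodMk (contDiff_pi.2 fun k => ?_)))
  exact (ContinuousLinearMap.contDiff _).comp contDiff_snd.snd

theorem support_smul_add_single_subset (u : ℤ →₀ ℝ) (k : ℤ) (s t : ℝ) :
    (s • u + Finsupp.single k t).support ⊆ insert k u.support := by
  intro l hl
  by_contra h
  simp only [Finset.mem_insert, Finsupp.mem_support_iff, not_or, not_not] at h
  simp [h.2, Finsupp.single_eq_of_ne h.1] at hl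

theorem IsSmooth.line {f : Fn} (hf : IsSmooth f) (u : ℤ →₀ ℝ) (k : ℤ) :
    ContDiff ℝ ∞ fun p : ℝ × ℝ × ℝ => f p.1 p.2.1 (u + Finsupp.single k p.2.2) := by
  -- The affine line `u + t e_k` is the slice `s = 1` of the linear map `(s, t) ↦ s u + t e_k`.
  let L : ℝ × ℝ →ₗ[ℝ] (ℤ →₀ ℝ) :=
    (LinearMap.toSpanSingleton ℝ _ u).coprod (Finsupp.lsingle k)
  have hL : ∀ e, L e = e.1 • u + Finsupp.single k e.2 := fun e => by simp [L]
  have h := hf.comp_linear L (insert k u.support) fun e => by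
    rw [hL]; exact support_smul_add_single_subset u k _ _
  have h2 := h.comp (contDiff_fst.prodMk (contDiff_snd.fst.prodMk
    (contDiff_const.prodMk contDiff_snd.snd)) :
      ContDiff ℝ ∞ fun p : ℝ × ℝ × ℝ => (p.1, p.2.1, ((1 : ℝ), p.2.2)))
  simpa [Function.comp_def, hL] using h2

theorem IsSmooth.plane {f : Fn} (hf : IsSmooth f) (u : ℤ →₀ ℝ) :
    ContDiff ℝ ∞ fun p : ℝ × ℝ => f p.1 p.2 u := by
  have h := (hf.line u 0).comp (contDiff_fst.prodMk (contDiff_snd.prodMk contDiff_const) :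
    ContDiff ℝ ∞ fun p : ℝ × ℝ => (p.1, p.2, (0 : ℝ)))
  simpa [Function.comp_def] using h

theorem IsSmooth.contDiff_x {f : Fn} (hf : IsSmooth f) (y : ℝ) (u : ℤ →₀ ℝ) :
    ContDiff ℝ ∞ fun x => f x y u :=
  (hf.plane u).comp (contDiff_id.prodMk contDiff_const)

theorem IsSmooth.contDiff_y {f : Fn} (hf : IsSmooth f) (x : ℝ) (u : ℤ →₀ ℝ) :
    ContDiff ℝ ∞ fun y => f x y u :=
  (hf.plane u).comp (contDiff_const.prodMk contDiff_id)

theorem IsSmooth.contDiff_u {f : Fn} (hf : IsSmooth f) (x y : ℝ) (u : ℤ →₀ ℝ) (k : ℤ) :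
    ContDiff ℝ ∞ fun t => f x y (u + Finsupp.single k t) :=
  (hf.line u k).comp (contDiff_const.prodMk (contDiff_const.prodMk contDiff_id))

theorem deriv_partial_contDiff {E : Type*} [NormedAddCommGroup E] [NormedSpace ℝ E]
    {F : E → ℝ} (hF : ContDiff ℝ ∞ F) {G : Type*} [NormedAddCommGroup G] [NormedSpace ℝ G]
    (g : G → E) (hg : ContDiff ℝ ∞ g) (v : E) :
    ContDiff ℝ ∞ fun p => deriv (fun t : ℝ => F (g p + t • v)) 0 := by
  have h : ∀ p, deriv (fun t : ℝ => F (g p + t • v)) 0 = fderiv ℝ F (g p) v := by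
    intro p
    have h1 : HasDerivAt (fun t : ℝ => g p + t • v) v 0 := by
      simpa using ((hasDerivAt_id (0 : ℝ)).smul_const v).const_add (g p)
    have h2 : HasFDerivAt F (fderiv ℝ F (g p)) (g p + (0 : ℝ) • v) := by
      simpa using (hF.differentiable (by simp) (g p)).hasFDerivAt
    exact (h2.comp_hasDerivAt (0 : ℝ) h1).deriv
  simp only [h]
  have h3 : ContDiff ℝ ∞ (fderiv ℝ F) := hF.fderiv_right (by simp)
  exact (h3.comp hg).clm_apply contDiff_const

theorem deriv_eq_deriv_add_zero (g : ℝ → ℝ) (x : ℝ) :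
    deriv g x = deriv (fun t => g (x + t)) 0 := by
  rw [deriv_comp_const_add, add_zero]

theorem IsSmooth.partialX {f : Fn} (hf : IsSmooth f) : IsSmooth (dX f) := by
  intro I
  have h := deriv_partial_contDiff (hf I) id contDiff_id ((1 : ℝ), (0 : ℝ), 0)
  convert h using 2 with p
  simp only [dX]
  rw [deriv_eq_deriv_add_zero]
  simp

theorem IsSmooth.partialY {f : Fn} (hf : IsSmooth f) : IsSmooth (dY f) := by
  intro I
  have h := deriv_partial_contDiff (hf I) id contDiff_id ((0 : ℝ), (1 : ℝ), 0)
  convert h using 2 with p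
  simp only [dY]
  rw [deriv_eq_deriv_add_zero]
  simp

theorem IsSmooth.partialU {f : Fn} (hf : IsSmooth f) (l : ℤ) : IsSmooth (dU l f) := by
  intro I
  let L : (I → ℝ) × ℝ →ₗ[ℝ] (ℤ →₀ ℝ) :=
    (∑ k : I, Finsupp.lsingle (k : ℤ) ∘ₗ LinearMap.proj k).coprod (Finsupp.lsingle l)
  have hL : ∀ e, L e = ∑ k : I, Finsupp.single (k : ℤ) (e.1 k) + Finsupp.single l e.2 :=
    fun e => by simp [L]
  have h := hf.comp_linear L (insert l I) fun e => by
    rw [hL]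
    intro j hj
    by_contra h
    simp only [Finset.mem_insert, not_or] at h
    rw [Finsupp.mem_support_iff, Finsupp.add_apply, Finsupp.single_eq_of_ne h.1,
      Finsupp.finsetSum_apply, Finset.sum_eq_zero, add_zero] at hj
    · exact hj rfl
    · intro k _
      exact Finsupp.single_eq_of_ne fun hk => h.2 (hk ▸ k.2)
  have h2 := deriv_partial_contDiff h
    (fun p : ℝ × ℝ × (I → ℝ) => (p.1, p.2.1, (p.2.2, (0 : ℝ))))
    (contDiff_fst.prodMk (contDiff_snd.fst.prodMk (contDiff_snd.snd.prodMk contDiff_const)))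
    ((0 : ℝ), (0 : ℝ), ((0 : I → ℝ), (1 : ℝ)))
  convert h2 using 2 with p
  simp [dU, hL]

theorem IsSmooth.add {f g : Fn} (hf : IsSmooth f) (hg : IsSmooth g) : IsSmooth (f + g) :=
  fun I => (hf I).add (hg I)

theorem isSmooth_of_plane {g : ℝ → ℝ → ℝ} (hg : ContDiff ℝ ∞ fun p : ℝ × ℝ => g p.1 p.2) :
    IsSmooth fun x y _ => g x y :=
  fun _ => hg.comp (contDiff_fst.prodMk contDiff_snd.fst)

theorem isSmooth_linForm (c : ℤ → ℝ) : IsSmooth fun _ _ u => linForm c u := by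
  intro I
  simp only [map_sum, linForm_single]
  exact ContDiff.sum fun k _ => contDiff_const.mul
    ((contDiff_apply ℝ ℝ k).comp contDiff_snd.snd)

/-- The derivative of `t ↦ f (u + t e_k)` at an arbitrary time. -/
theorem deriv_line (f : Fn) (x y : ℝ) (u : ℤ →₀ ℝ) (k : ℤ) (t : ℝ) :
    deriv (fun t => f x y (u + Finsupp.single k t)) t = dU k f x y (u + Finsupp.single k t) := by
  rw [deriv_eq_deriv_add_zero]
  simp only [dU, Finsupp.single_add, add_assoc]

/-- A finitely supported `u` is reached from `0` by finitely many moves along coordinate lines, on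
each of which `f` is affine. -/
theorem IsSmooth.eq_of_deriv_line {f : Fn} (hf : IsSmooth f) {x y : ℝ} {c : ℤ → ℝ}
    (h : ∀ k u, dU k f x y u = c k) (u : ℤ →₀ ℝ) : f x y u = f x y 0 + linForm c u := by
  have step : ∀ (u : ℤ →₀ ℝ) (k : ℤ) (a : ℝ),
      f x y (u + Finsupp.single k a) = f x y u + c k * a := by
    intro u k a
    have hd : ∀ t, HasDerivAt (fun t => f x y (u + Finsupp.single k t) - c k * t)
        (c k - c k * 1) t := by
      intro t
      refine HasDerivAt.sub ?_ ((hasDerivAt_id t).const_mul (c k))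
      rw [← h k (u + Finsupp.single k t), ← deriv_line]
      exact ((hf.contDiff_u x y u k).differentiable (by simp) t).hasDerivAt
    have := is_const_of_deriv_eq_zero (fun t => (hd t).differentiableAt)
      (fun t => by rw [(hd t).deriv]; ring) a 0
    simp only [Finsupp.single_zero, add_zero, mul_zero, sub_zero] at this
    linarith
  induction u using Finsupp.induction with
  | zero => simp
  | single_add k a u _ _ ih =>
    rw [add_comm, step, ih, map_add, linForm_single]
    ring

theorem IsSmooth.eq_of_dU_eq_zero {f : Fn} (hf : IsSmooth f) {x y : ℝ}
    (h : ∀ k u, dU k f x y u = 0) (u : ℤ →₀ ℝ) : f x y u = f x y 0 := by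
  have := hf.eq_of_deriv_line (c := 0) h u
  simpa using this

theorem IsSmooth.eq_of_dX_eq {f : Fn} (hf : IsSmooth f) {y y' : ℝ} {u u' : ℤ →₀ ℝ}
    (h : ∀ x, dX f x y u = dX f x y' u') (x x' : ℝ) :
    f x y u - f x y' u' = f x' y u - f x' y' u' := by
  have h₁ := (hf.contDiff_x y u).differentiable (by simp)
  have h₂ := (hf.contDiff_x y' u').differentiable (by simp)
  refine is_const_of_deriv_eq_zero (f := fun x => f x y u - f x y' u') (h₁.sub h₂) ?_ x x'
  intro t
  rw [deriv_fun_sub (h₁ t) (h₂ t)]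
  exact sub_eq_zero.2 (h t)

theorem IsSmooth.eq_of_dY_eq {f : Fn} (hf : IsSmooth f) {x x' : ℝ} {u u' : ℤ →₀ ℝ}
    (h : ∀ y, dY f x y u = dY f x' y u') (y y' : ℝ) :
    f x y u - f x' y u' = f x y' u - f x' y' u' := by
  have h₁ := (hf.contDiff_y x u).differentiable (by simp)
  have h₂ := (hf.contDiff_y x' u').differentiable (by simp)
  refine is_const_of_deriv_eq_zero (f := fun y => f x y u - f x' y u') (h₁.sub h₂) ?_ y y'
  intro t
  rw [deriv_fun_sub (h₁ t) (h₂ t)]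
  exact sub_eq_zero.2 (h t)

/-! ### Independence of the exponentials -/

/-- The shift operator `f ↦ f (· + 1)`. -/
def shift : Module.End ℝ (ℝ → ℝ) where
  toFun f t := f (t + 1)
  map_add' _ _ := rfl
  map_smul' _ _ := rfl

/-- The second power of `shift - exp l` annihilates an affine function times `exp (t * l)`. -/
theorem affine_mul_exp_mem_maxGenEigenspace (a b l : ℝ) :
    (fun t => Real.exp (t * l) * (a + t * b)) ∈ shift.maxGenEigenspace (Real.exp l) := by
  rw [Module.End.mem_maxGenEigenspace]
  refine ⟨2, ?_⟩
  funext t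
  simp only [pow_two, Module.End.mul_apply, LinearMap.sub_apply, LinearMap.smul_apply,
    Module.End.one_apply, shift, LinearMap.coe_mk, AddHom.coe_mk, Pi.sub_apply, Pi.smul_apply,
    smul_eq_mul, Pi.zero_apply, add_mul, one_mul, Real.exp_add]
  ring

/-- Generalized eigenspaces of the shift for distinct eigenvalues are independent. Only the exponent
of `i₀` has to differ from the others, which may coincide among themselves. -/
theorem eq_zero_of_sum_affine_mul_exp_eq_zero {ι : Type*} [DecidableEq ι] {s : Finset ι} {i₀ : ι}
    (hi₀ : i₀ ∈ s) {l a b : ι → ℝ} (hl : ∀ i ∈ s, i ≠ i₀ → l i ≠ l i₀)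
    (h : ∀ t, ∑ i ∈ s, Real.exp (t * l i) * (a i + t * b i) = 0) : a i₀ = 0 ∧ b i₀ = 0 := by
  let g : ι → ℝ → ℝ := fun i t => Real.exp (t * l i) * (a i + t * b i)
  have hg : ∀ i, g i ∈ shift.maxGenEigenspace (Real.exp (l i)) :=
    fun i => affine_mul_exp_mem_maxGenEigenspace _ _ _
  have hsum : g i₀ = -∑ i ∈ s.erase i₀, g i := by
    rw [eq_neg_iff_add_eq_zero, Finset.add_sum_erase _ _ hi₀]
    funext t
    simpa using h t
  have hmem : g i₀ ∈ ⨆ μ, ⨆ _ : μ ≠ Real.exp (l i₀), shift.maxGenEigenspace μ := by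
    rw [hsum]
    refine Submodule.neg_mem _ (Submodule.sum_mem _ fun i hi => ?_)
    rw [Finset.mem_erase] at hi
    exact Submodule.mem_iSup_of_mem (Real.exp (l i)) (Submodule.mem_iSup_of_mem
      (fun h => hl i hi.2 hi.1 (Real.exp_injective h)) (hg i))
  have h0 : g i₀ = 0 := Submodule.disjoint_def.1
    (shift.independent_maxGenEigenspace (Real.exp (l i₀))) _ (hg i₀) hmem
  have e0 := congrFun h0 0
  have e1 := congrFun h0 1
  simp only [g, Pi.zero_apply, mul_eq_zero, Real.exp_ne_zero, false_or] at e0 e1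
  constructor <;> linarith

theorem eventually_affine_ne_zero {a b : ℝ} (h : a ≠ 0 ∨ b ≠ 0) :
    ∀ᶠ ε in nhdsWithin (0 : ℝ) {0}ᶜ, a + ε * b ≠ 0 := by
  by_cases ha : a = 0
  · filter_upwards [self_mem_nhdsWithin] with ε hε
    have hb : b ≠ 0 := by tauto
    rw [ha, zero_add]
    exact mul_ne_zero hε hb
  · refine Filter.Eventually.filter_mono nhdsWithin_le_nhds ?_
    have hc : Continuous fun ε : ℝ => a + ε * b := by fun_prop
    exact hc.continuousAt.eventually_ne (by simpa using ha)

section generic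

variable {H : Matrix ℤ ℤ ℝ} {a b : ℤ}

theorem IsBand.finite_linForm_ne_zero (hH : IsBand H a b) (u : ℤ →₀ ℝ) :
    {m | linForm (H m) u ≠ 0}.Finite := by
  refine Set.Finite.subset (u.support.finite_toSet.biUnion fun l _ =>
    Set.finite_Icc (l - b) (l - a)) ?_
  intro m hm
  rw [Set.mem_ofPred_eq, linForm_eq_sum _ subset_rfl] at hm
  obtain ⟨l, hl, h⟩ := Finset.exists_ne_zero_of_sum_ne_zero hm
  have := hH.mem_of_ne_zero (right_ne_zero_of_mul h)
  simp only [Set.mem_iUnion]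
  exact ⟨l, hl, by rw [Set.mem_Icc]; omega⟩

/-- In the direction `w`, the `m₀`-th exponent differs from `0` and from all other exponents. -/
def IsGeneric (H : Matrix ℤ ℤ ℝ) (m₀ : ℤ) (w : ℤ →₀ ℝ) : Prop :=
  linForm (H m₀) w ≠ 0 ∧ ∀ m ≠ m₀, linForm (H m) w ≠ linForm (H m₀) w

/-- Only finitely many exponents are nonzero on `w` or `e_k`, and each of them excludes at most one
`ε`. All other exponents stay `0`, so they are handled by the first condition. -/
theorem IsBand.exists_isGeneric_add (hH : IsBand H a b) {m₀ : ℤ} (w : ℤ →₀ ℝ) (k : ℤ)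
    (h₀ : linForm (H m₀) w ≠ 0 ∨ H m₀ k ≠ 0)
    (h : ∀ m ≠ m₀, linForm (H m₀) w ≠ linForm (H m) w ∨ H m₀ k ≠ H m k) :
    ∃ ε : ℝ, ε ≠ 0 ∧ IsGeneric H m₀ (w + Finsupp.single k ε) := by
  have hfin := (hH.finite_linForm_ne_zero w).union
    (hH.finite_linForm_ne_zero (Finsupp.single k 1))
  have e0 := eventually_affine_ne_zero h₀
  have e1 : ∀ᶠ ε in nhdsWithin (0 : ℝ) {0}ᶜ, ∀ m ∈ hfin.toFinset, m ≠ m₀ →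
      (linForm (H m₀) w - linForm (H m) w) + ε * (H m₀ k - H m k) ≠ 0 := by
    rw [Filter.eventually_all_finset]
    intro m _
    by_cases hm : m = m₀
    · exact Filter.Eventually.of_forall fun _ h' => absurd hm h'
    · filter_upwards [eventually_affine_ne_zero
        ((h m hm).imp sub_ne_zero.2 sub_ne_zero.2)] with ε hε _ using hε
  obtain ⟨ε, ⟨he0, he1⟩, hne⟩ := ((e0.and e1).and self_mem_nhdsWithin).exists
  have hL : ∀ m, linForm (H m) (w + Finsupp.single k ε) = linForm (H m) w + ε * H m k := by
    intro m
    rw [map_add, linForm_single, mul_comm]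
  refine ⟨ε, hne, by rwa [hL], fun m hm => ?_⟩
  by_cases hmf : m ∈ hfin.toFinset
  · intro h'
    refine he1 m hmf hm ?_
    rw [hL, hL] at h'
    linarith
  · simp only [Set.Finite.mem_toFinset, Set.mem_union, Set.mem_ofPred_eq, linForm_single, mul_one,
      not_or, not_not] at hmf
    rw [hL, hL, hmf.1, hmf.2, mul_zero, add_zero]
    exact he0.symm

/-- Rows `m < m₀` vanish at column `m₀ + b` and rows `m > m₀` at column `m₀ + a`, while row `m₀`
vanishes at neither. Hence `e_{m₀+a} + ε e_{m₀+b}` works for a suitable `ε`. -/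
theorem IsBand.exists_isGeneric (hH : IsBand H a b) (m₀ : ℤ) : ∃ w, IsGeneric H m₀ w := by
  have h1 := (hH.2.2 m₀).1
  have h2 := (hH.2.2 m₀).2
  obtain ⟨ε, -, h⟩ := hH.exists_isGeneric_add (m₀ := m₀) (Finsupp.single (m₀ + a) 1) (m₀ + b)
    (Or.inr h2) (by
      intro m hm
      rcases lt_or_gt_of_ne hm with hlt | hgt
      · right
        rw [hH.eq_zero_of_notMem (n := m) (by rw [Finset.mem_Icc]; omega)]
        exact h2
      · left
        rw [linForm_single, linForm_single,
          hH.eq_zero_of_notMem (n := m) (by rw [Finset.mem_Icc]; omega)]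
        simpa using h1)
  exact ⟨_, h⟩

theorem IsBand.coeff_eq_of_hasSum_exp (hH : IsBand H a b) {B t : ℤ → ℝ}
    {N : ℤ → (ℤ →₀ ℝ) →ₗ[ℝ] ℝ} {S : Finset ℤ} {c : ℝ} (ht : ∀ m ∉ S, t m = 0)
    (hN : ∀ m ∉ S, N m = 0)
    (h : ∀ u, HasSum (fun m => B m * Real.exp (linForm (H m) u))
      (∑ m ∈ S, Real.exp (linForm (H m) u) * (t m + N m u) - c)) (m₀ : ℤ) :
    B m₀ = t m₀ ∧ N m₀ = 0 := by
  have key : ∀ w, IsGeneric H m₀ w → B m₀ = t m₀ ∧ N m₀ w = 0 := by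
    intro w hw
    have hfin := hH.finite_linForm_ne_zero w
    let M : Finset ℤ := insert m₀ (S ∪ hfin.toFinset)
    have hSM : S ⊆ M := fun m hm => Finset.mem_insert_of_mem (Finset.mem_union_left _ hm)
    have hM0 : ∀ m ∉ M, linForm (H m) w = 0 := by
      intro m hm
      by_contra h'
      exact hm (Finset.mem_insert_of_mem (Finset.mem_union_right _ (by simpa using h')))
    have hS : ∀ u, ∑ m ∈ S, Real.exp (linForm (H m) u) * (t m + N m u) =
        ∑ m ∈ M, Real.exp (linForm (H m) u) * (t m + N m u) := by
      intro u
      refine Finset.sum_subset hSM fun m _ hm => ?_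
      rw [ht m hm, hN m hm]
      simp
    -- Subtracting the identity at `u = 0` removes `c` and every term of the series outside `M`,
    -- where the exponent is `0` along the line `τ • w`.
    have hdiff : ∀ τ : ℝ, ∑ m ∈ M, B m * (Real.exp (τ * linForm (H m) w) - 1) =
        ∑ m ∈ M, (Real.exp (τ * linForm (H m) w) * (t m + τ * N m w) - t m) := by
      intro τ
      have h1 := (h (τ • w)).sub (h 0)
      rw [hS, hS] at h1
      have h2 : HasSum (fun m => B m * Real.exp (linForm (H m) (τ • w)) -
          B m * Real.exp (linForm (H m) 0))
          (∑ m ∈ M, (B m * Real.exp (linForm (H m) (τ • w)) -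
          B m * Real.exp (linForm (H m) 0))) := by
        refine hasSum_sum_of_ne_finset_zero fun m hm => ?_
        rw [map_smul, hM0 m hm]
        simp
      have h3 := h2.unique h1
      simp only [map_smul, map_zero, smul_eq_mul, Real.exp_zero, mul_one, add_zero, one_mul] at h3
      simp only [mul_sub, mul_one, Finset.sum_sub_distrib] at h3 ⊢
      linarith
    -- The index `none` carries the constant left by the subtraction, with exponent `0`; this is why
    -- a generic direction must also have a nonzero exponent at `m₀`.
    have hsum : ∀ τ : ℝ, ∑ i ∈ M.map Function.Embedding.some ∪ {none},
        Real.exp (τ * (i.elim 0 fun m => linForm (H m) w)) *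
          ((i.elim (-∑ m ∈ M, (B m - t m)) fun m => B m - t m) +
            τ * (i.elim 0 fun m => -N m w)) = 0 := by
      intro τ
      rw [Finset.sum_union (by simp), Finset.sum_map, Finset.sum_singleton]
      have h1 := sub_eq_zero.2 (hdiff τ)
      simp only [Function.Embedding.some_apply, Option.elim_some, Option.elim_none, mul_zero,
        Real.exp_zero, one_mul, add_zero]
      rw [← h1, ← sub_eq_add_neg, ← Finset.sum_sub_distrib, ← Finset.sum_sub_distrib]
      exact Finset.sum_congr rfl fun m _ => by ring
    have := eq_zero_of_sum_affine_mul_exp_eq_zero (i₀ := some m₀) (by simp [M]) (by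
      rintro (_ | m) _ hm
      · exact hw.1.symm
      · exact hw.2 m (by simpa using hm)) hsum
    exact ⟨sub_eq_zero.1 this.1, neg_eq_zero.1 this.2⟩
  obtain ⟨w, hw⟩ := hH.exists_isGeneric m₀
  refine ⟨(key w hw).1, ?_⟩
  ext k
  -- `N m₀` vanishes on the generic directions `w` and `w + ε e_k`, hence on `e_k`.
  obtain ⟨ε, hε, hg⟩ := hH.exists_isGeneric_add w k (Or.inl hw.1)
    fun m hm => Or.inl (hw.2 m hm).symm
  have h1 := (key _ hg).2
  rw [map_add, (key w hw).2, zero_add, ← mul_one ε, ← smul_eq_mul, ← Finsupp.smul_single,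
    map_smul, smul_eq_mul] at h1
  simpa using (mul_eq_zero.1 h1).resolve_left hε

end generic

/-! ### Vector fields that are affine in the fields -/

/-- `ξ(x) ∂_x + η(y) ∂_y + ∑_n (g_n(x, y) + ∑_k A_{nk} u_k) ∂_{u_n}`. -/
def affineField (ξ η : ℝ → ℝ) (g : ℤ → ℝ → ℝ → ℝ) (A : ℤ → ℤ → ℝ) : VField :=
  (fun x _ _ => ξ x, fun _ y _ => η y, fun n x y u => g n x y + linForm (A n) u)

section affine

variable {ξ η : ℝ → ℝ} {g : ℤ → ℝ → ℝ → ℝ} {A : ℤ → ℤ → ℝ}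

@[simp]
theorem affineField_cx : (affineField ξ η g A).cx = fun x _ _ => ξ x := rfl

@[simp]
theorem affineField_cy : (affineField ξ η g A).cy = fun _ y _ => η y := rfl

@[simp]
theorem affineField_cu (n : ℤ) :
    (affineField ξ η g A).cu n = fun x y u => g n x y + linForm (A n) u := rfl

theorem smooth_affineField (hξ : ContDiff ℝ ∞ ξ) (hη : ContDiff ℝ ∞ η)
    (hg : ∀ n, ContDiff ℝ ∞ fun p : ℝ × ℝ => g n p.1 p.2) : (affineField ξ η g A).Smooth :=
  ⟨isSmooth_of_plane (g := fun x _ => ξ x) (hξ.comp contDiff_fst),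
    isSmooth_of_plane (g := fun _ y => η y) (hη.comp contDiff_snd),
    fun n => (isSmooth_of_plane (hg n)).add (isSmooth_linForm (A n))⟩

theorem dU_x (k : ℤ) (ξ : ℝ → ℝ) : dU k (fun x _ _ => ξ x) = 0 := by
  funext x y u
  simp [dU]

theorem dU_y (k : ℤ) (η : ℝ → ℝ) : dU k (fun _ y _ => η y) = 0 := by
  funext x y u
  simp [dU]

theorem dU_plane (k : ℤ) (g : ℝ → ℝ → ℝ) : dU k (fun x y _ => g x y) = 0 := by
  funext x y u
  simp [dU]

theorem dU_affine (k : ℤ) (g : ℝ → ℝ → ℝ) (c : ℤ → ℝ) :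
    dU k (fun x y u => g x y + linForm c u) = fun _ _ _ => c k := by
  funext x y u
  simp only [dU, map_add, linForm_single]
  rw [deriv_const_add, deriv_const_add]
  simp

theorem dX_affine (g : ℝ → ℝ → ℝ) (c : ℤ → ℝ) :
    dX (fun x y u => g x y + linForm c u) = fun x y _ => deriv (fun t => g t y) x := by
  funext x y u
  simp only [dX, deriv_add_const]

theorem dY_affine (g : ℝ → ℝ → ℝ) (c : ℤ → ℝ) :
    dY (fun x y u => g x y + linForm c u) = fun x y _ => deriv (g x) y := by
  funext x y u
  simp only [dY, deriv_add_const]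

theorem dX_y (η : ℝ → ℝ) : dX (fun _ y _ => η y) = 0 := by
  funext x y u
  simp [dX]

theorem dY_x (ξ : ℝ → ℝ) : dY (fun x _ _ => ξ x) = 0 := by
  funext x y u
  simp [dY]

theorem dX_x (ξ : ℝ → ℝ) : dX (fun x _ _ => ξ x) = fun x _ _ => deriv ξ x := rfl

theorem dY_y (η : ℝ → ℝ) : dY (fun _ y _ => η y) = fun _ y _ => deriv η y := rfl

theorem dX_zero : dX 0 = 0 := by
  funext x y u
  simp [dX]

theorem dU_zero (k : ℤ) : dU k 0 = 0 := by
  funext x y u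
  simp [dU]

end affine

/-! ### The symmetry condition for affine fields -/

section force

variable {H K : Matrix ℤ ℤ ℝ} {p₁ p₂ q₁ q₂ : ℤ}

theorem expTerm_apply (H : Matrix ℤ ℤ ℝ) (m : ℤ) (x y : ℝ) (u : ℤ →₀ ℝ) :
    expTerm H m x y u = Real.exp (linForm (H m) u) := by
  rw [linForm_apply]
  rfl

theorem force_eq_sum (hK : IsBand K.transpose q₁ q₂) (n : ℤ) (x y : ℝ) (u : ℤ →₀ ℝ) :
    force H K n x y u =
      ∑ m ∈ Finset.Icc (n - q₂) (n - q₁), K n m * Real.exp (linForm (H m) u) := by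
  simp only [force, expTerm_apply]
  refine finsum_eq_sum_of_support_subset _ fun m hm => ?_
  rw [Function.mem_support] at hm
  have h := hK.mem_of_ne_zero (n := m) (k := n) (left_ne_zero_of_mul hm)
  rw [Finset.coe_Icc, Set.mem_Icc]
  omega

theorem dU_force (hK : IsBand K.transpose q₁ q₂) (n k : ℤ) (x y : ℝ) (u : ℤ →₀ ℝ) :
    dU k (force H K n) x y u =
      ∑ m ∈ Finset.Icc (n - q₂) (n - q₁), K n m * Real.exp (linForm (H m) u) * H m k := by
  simp only [dU, force_eq_sum hK]
  have h : ∀ m, HasDerivAt (fun t => K n m * Real.exp (linForm (H m) (u + Finsupp.single k t)))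
      (K n m * Real.exp (linForm (H m) u) * H m k) 0 := by
    intro m
    have h1 : HasDerivAt (fun t => linForm (H m) (u + Finsupp.single k t)) (H m k) 0 := by
      simp only [map_add, linForm_single]
      simpa using ((hasDerivAt_id (0 : ℝ)).const_mul (H m k)).const_add (linForm (H m) u)
    have h2 := h1.exp.const_mul (K n m)
    simpa [mul_assoc] using h2
  exact (HasDerivAt.fun_sum fun m _ => h m).deriv

theorem finsum_mul_dU_force (hH : IsBand H p₁ p₂) (hK : IsBand K.transpose q₁ q₂) (n : ℤ)
    (f : ℤ → ℝ) (x y : ℝ) (u : ℤ →₀ ℝ) :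
    ∑ᶠ α, f α * dU α (force H K n) x y u = ∑ m ∈ Finset.Icc (n - q₂) (n - q₁),
      K n m * Real.exp (linForm (H m) u) * diffOp H p₁ p₂ f m := by
  simp only [dU_force hK, Finset.mul_sum]
  rw [finsum_sum_comm]
  · refine Finset.sum_congr rfl fun m _ => ?_
    rw [← hH.finsum_eq_diffOp, mul_finsum]
    exact finsum_congr fun α => by ring
  · intro m _
    refine (Set.finite_Icc (m + p₁) (m + p₂)).subset fun α hα => ?_
    exact hH.mem_of_ne_zero (right_ne_zero_of_mul (right_ne_zero_of_mul hα))

theorem prolongExp_affineField (hK : IsBand K.transpose q₁ q₂) (ξ η : ℝ → ℝ)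
    (g : ℤ → ℝ → ℝ → ℝ) (A : ℤ → ℤ → ℝ) (n : ℤ) (j : Jet) (m : ℤ) :
    prolongExp H K (affineField ξ η g A) n j m =
      diffOp K.transpose q₁ q₂ (A n) m * Real.exp (linForm (H m) j.u) := by
  simp only [prolongExp, totXYexp, affineField_cx, affineField_cy, affineField_cu, dU_x, dU_y,
    dU_affine, expTerm_apply, Pi.zero_apply, zero_mul, finsum_zero, mul_zero, sub_zero]
  rw [← hK.finsum_eq_diffOp]
  rfl

theorem prolongFree_affineField (hH : IsBand H p₁ p₂) (hK : IsBand K.transpose q₁ q₂)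
    (ξ η : ℝ → ℝ) (g : ℤ → ℝ → ℝ → ℝ) (A : ℤ → ℤ → ℝ) (n : ℤ) (j : Jet) :
    prolongFree H K (affineField ξ η g A) n j =
      deriv (fun x => deriv (g n x) j.y) j.x - ∑ m ∈ Finset.Icc (n - q₂) (n - q₁),
        K n m * Real.exp (linForm (H m) j.u) * (deriv ξ j.x + deriv η j.y +
          diffOp H p₁ p₂ (fun α => g α j.x j.y + linForm (A α) j.u) m) := by
  have h1 : totXYfree (fun x _ _ => ξ x) j = 0 := by
    simp [totXYfree, dY_x, dX_zero, dX_x, dU_x, dU_zero]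
  have h2 : totXYfree (fun _ y _ => η y) j = 0 := by
    simp [totXYfree, dX_y, dY_y, dU_y, dU_zero]
  have h3 : totXYfree (fun x y u => g n x y + linForm (A n) u) j =
      deriv (fun x => deriv (g n x) j.y) j.x := by
    simp only [totXYfree, dY_affine, dX_affine, dU_affine, dU_plane, Pi.zero_apply,
      mul_zero, Finsupp.sum, Finset.sum_const_zero, add_zero]
    rfl
  have h4 : totX (fun x _ _ => ξ x) j = deriv ξ j.x := by simp [totX, dX_x, dU_x]
  have h5 : totY (fun x _ _ => ξ x) j = 0 := by simp [totY, dY_x, dU_x]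
  have h6 : totY (fun _ y _ => η y) j = deriv η j.y := by simp [totY, dY_y, dU_y]
  have h7 : totX (fun _ y _ => η y) j = 0 := by simp [totX, dX_y, dU_y]
  simp only [prolongFree, affineField_cx, affineField_cy, affineField_cu, h1, h2, h3, h4, h5, h6,
    h7, finsum_mul_dU_force hH hK, force_eq_sum hK, mul_zero, sub_zero, mul_add (_ * _),
    Finset.sum_add_distrib, Finset.sum_mul]
  ring

end force

/-! ### The normal form of a point symmetry -/

/-- The conditions on `ξ, η, g, A` under which `affineField ξ η g A` is a point symmetry. -/
structure IsSymmetryData (H K : Matrix ℤ ℤ ℝ) (p₁ p₂ q₁ q₂ : ℤ) (ξ η : ℝ → ℝ)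
    (g : ℤ → ℝ → ℝ → ℝ) (A : ℤ → ℤ → ℝ) : Prop where
  contDiff_x : ContDiff ℝ ∞ ξ
  contDiff_y : ContDiff ℝ ∞ η
  contDiff_plane : ∀ n, ContDiff ℝ ∞ fun p : ℝ × ℝ => g n p.1 p.2
  split : ∀ n x y, g n x y = g n x 0 + g n 0 y - g n 0 0
  diffOp_plane : ∀ m x y, diffOp H p₁ p₂ (fun n => g n x y) m = -(deriv ξ x + deriv η y)
  diffOp_col : ∀ k, diffOp H p₁ p₂ (fun n => A n k) = 0
  diffOp_row : ∀ n, diffOp K.transpose q₁ q₂ (A n) = 0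

section

variable {H K : Matrix ℤ ℤ ℝ} {p₁ p₂ q₁ q₂ : ℤ}

theorem diffOp_linForm (A : ℤ → ℤ → ℝ) (m : ℤ) (u : ℤ →₀ ℝ) :
    diffOp H p₁ p₂ (fun α => linForm (A α) u) m =
      linForm (fun k => diffOp H p₁ p₂ (fun n => A n k) m) u := by
  simp only [linForm_eq_sum _ subset_rfl, diffOp_eq_sum_Icc, Finset.mul_sum]
  rw [Finset.sum_comm]
  exact Finset.sum_congr rfl fun _ _ => Finset.sum_congr rfl fun _ _ => by ring

theorem IsSymmetryData.isPointSymmetry (hH : IsBand H p₁ p₂) (hK : IsBand K.transpose q₁ q₂)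
    {ξ η : ℝ → ℝ} {g : ℤ → ℝ → ℝ → ℝ} {A : ℤ → ℤ → ℝ}
    (h : IsSymmetryData H K p₁ p₂ q₁ q₂ ξ η g A) :
    IsPointSymmetry H K (affineField ξ η g A) := by
  refine ⟨smooth_affineField h.contDiff_x h.contDiff_y h.contDiff_plane, fun n j => ?_⟩
  have h1 : prolongExp H K (affineField ξ η g A) n j = 0 := by
    funext m
    rw [prolongExp_affineField hK, h.diffOp_row]
    simp
  have h2 : deriv (fun x => deriv (g n x) j.y) j.x = 0 := by
    have : ∀ x, deriv (g n x) j.y = deriv (g n 0) j.y := by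
      intro x
      have : g n x = fun y => (g n x 0 - g n 0 0) + g n 0 y := by
        funext y
        rw [h.split]
        ring
      rw [this, deriv_const_add]
    simp only [this, deriv_const]
  have h3 : ∀ m, diffOp H p₁ p₂ (fun α => g α j.x j.y + linForm (A α) j.u) m =
      -(deriv ξ j.x + deriv η j.y) := by
    intro m
    change diffOp H p₁ p₂ ((fun α => g α j.x j.y) + fun α => linForm (A α) j.u) m = _
    rw [map_add, Pi.add_apply, diffOp_linForm, h.diffOp_plane]
    simp only [h.diffOp_col, Pi.zero_apply]
    exact add_eq_left.2 (linForm_zero_left _)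
  rw [h1, prolongFree_affineField hH hK, h2]
  simp only [h3, add_neg_cancel, mul_zero, Finset.sum_const_zero, sub_zero, neg_zero]
  exact hasSum_zero

/-- A multiple of a column of `K` has a lowest index `m + q₁`. In equation `m + q₁ - p₂` this is the
highest index, so a single term with nonzero coefficient survives. -/
theorem diffOp_col_mul_eq_zero (hH : IsBand H p₁ p₂) (hK : IsBand K.transpose q₁ q₂) {m : ℤ} {s : ℝ}
    {f : ℤ → ℝ} (hf : diffOp H p₁ p₂ f = 0) (h : ∀ n, f n = K n m * s) : s = 0 := by
  have h1 := congrFun hf (m + q₁ - p₂)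
  rw [diffOp_eq_sum_Icc, Finset.sum_eq_single (m + q₁)] at h1
  · have h2 := (hH.2.2 (m + q₁ - p₂)).2
    have h3 : K (m + q₁) m ≠ 0 := (hK.2.2 m).1
    rw [sub_add_cancel] at h2
    rw [h, Pi.zero_apply] at h1
    simpa [h2, h3] using h1
  · intro k hk hne
    rw [Finset.mem_Icc] at hk
    have : K k m = 0 := hK.eq_zero_of_notMem (n := m) (k := k) (by rw [Finset.mem_Icc]; omega)
    rw [h, this]
    simp
  · intro h'
    have := hH.1
    exact absurd (Finset.mem_Icc.2 (by omega)) h'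

theorem isSymmetryData_of_isPointSymmetry (hH : IsBand H p₁ p₂) (hK : IsBand K.transpose q₁ q₂)
    {ξ η : ℝ → ℝ} {g : ℤ → ℝ → ℝ → ℝ} {A : ℤ → ℤ → ℝ}
    (hξ : ContDiff ℝ ∞ ξ) (hη : ContDiff ℝ ∞ η)
    (hg : ∀ n, ContDiff ℝ ∞ fun p : ℝ × ℝ => g n p.1 p.2)
    (h : IsPointSymmetry H K (affineField ξ η g A)) :
    IsSymmetryData H K p₁ p₂ q₁ q₂ ξ η g A := by
  -- Comparison of the coefficients of the exponentials as functions of `u`, at jets whose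
  -- derivative coordinates all vanish.
  have key : ∀ n x y m, diffOp K.transpose q₁ q₂ (A n) m =
      K n m * (deriv ξ x + deriv η y + diffOp H p₁ p₂ (fun α => g α x y) m) ∧
      K n m • linForm (fun k => diffOp H p₁ p₂ (fun α => A α k) m) = 0 := by
    intro n x y
    have hK0 : ∀ m ∉ Finset.Icc (n - q₂) (n - q₁), K n m = 0 := fun m hm =>
      hK.eq_zero_of_notMem (n := m) (k := n) (by rw [Finset.mem_Icc] at hm ⊢; omega)
    refine hH.coeff_eq_of_hasSum_exp (S := Finset.Icc (n - q₂) (n - q₁))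
      (c := deriv (fun x => deriv (g n x) y) x) (fun m hm => by rw [hK0 m hm, zero_mul])
      (fun m hm => by rw [hK0 m hm, zero_smul]) fun u => ?_
    have h1 := h.2 n ⟨x, y, u, 0, 0, 0, 0⟩
    rw [prolongFree_affineField hH hK, neg_sub] at h1
    convert h1 using 1
    · funext m
      rw [prolongExp_affineField hK]
    · congr 1
      refine Finset.sum_congr rfl fun m _ => ?_
      have : (fun α => g α x y + linForm (A α) u) =
        (fun α => g α x y) + fun α => linForm (A α) u := rfl
      rw [this, map_add, Pi.add_apply, diffOp_linForm, LinearMap.smul_apply, smul_eq_mul]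
      ring
  have hcol : ∀ k, diffOp H p₁ p₂ (fun n => A n k) = 0 := by
    intro k
    funext m
    have h1 := (key (m + q₁) 0 0 m).2
    have h2 : K (m + q₁) m ≠ 0 := (hK.2.2 m).1
    have h3 := LinearMap.congr_fun ((smul_eq_zero.1 h1).resolve_left h2) (Finsupp.single k 1)
    simpa using h3
  -- By associativity of these finite products, `H(AK) = (HA)K = 0`; so the right-hand side of
  -- `key`, a multiple of a column of `K`, lies in `ker H`.
  have hzero : ∀ m x y, deriv ξ x + deriv η y + diffOp H p₁ p₂ (fun α => g α x y) m = 0 := by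
    intro m x y
    refine diffOp_col_mul_eq_zero hH hK (f := fun n => diffOp K.transpose q₁ q₂ (A n) m) ?_
      fun n => (key n x y m).1
    funext i
    simp only [diffOp_eq_sum_Icc, Finset.mul_sum]
    rw [Finset.sum_comm]
    refine Finset.sum_eq_zero fun k _ => ?_
    have := congrFun (hcol k) i
    rw [diffOp_eq_sum_Icc] at this
    have h2 := congrArg (K.transpose m k * ·) this
    simp only [Finset.mul_sum, Pi.zero_apply, mul_zero] at h2
    rw [← h2]
    exact Finset.sum_congr rfl fun _ _ => by ring
  have hrow : ∀ n, diffOp K.transpose q₁ q₂ (A n) = 0 := by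
    intro n
    funext m
    rw [(key n 0 0 m).1, hzero, mul_zero]
    rfl
  have hxy : ∀ n x y, deriv (fun x => deriv (g n x) y) x = 0 := by
    intro n x y
    have h1 := h.2 n ⟨x, y, 0, 0, 0, 0, 0⟩
    have h2 : prolongExp H K (affineField ξ η g A) n ⟨x, y, 0, 0, 0, 0, 0⟩ = 0 := by
      funext m
      rw [prolongExp_affineField hK, hrow]
      simp
    rw [h2, prolongFree_affineField hH hK] at h1
    simp only [map_zero, add_zero, hzero, mul_zero, Finset.sum_const_zero, sub_zero] at h1
    simpa using h1.unique hasSum_zero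
  refine ⟨hξ, hη, hg, fun n x y => ?_, fun m x y => ?_, hcol, hrow⟩
  · have hs : IsSmooth fun x y _ => g n x y := isSmooth_of_plane (hg n)
    have h1 : ∀ y, dY (fun x y _ => g n x y) x y 0 = dY (fun x y _ => g n x y) 0 y 0 :=
      fun y => is_const_of_deriv_eq_zero
        ((hs.partialY.contDiff_x y 0).differentiable (by simp)) (fun x => hxy n x y) x 0
    have := hs.eq_of_dY_eq h1 y 0
    linarith
  · have := hzero m x y
    linarith

theorem IsPointSymmetry.exists_affineField {v : VField} (h : IsPointSymmetry H K v) :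
    ∃ (ξ η : ℝ → ℝ) (g : ℤ → ℝ → ℝ → ℝ) (A : ℤ → ℤ → ℝ), ContDiff ℝ ∞ ξ ∧ ContDiff ℝ ∞ η ∧
      (∀ n, ContDiff ℝ ∞ fun p : ℝ × ℝ => g n p.1 p.2) ∧ v = affineField ξ η g A := by
  obtain ⟨⟨hcx, hcy, hcu⟩, hs⟩ := h
  have e₁ : ∀ (f : Fn) (j : Jet) w z, totXYfree f ⟨j.x, j.y, j.u, j.ux, j.uy, w, z⟩ =
    totXYfree f j := fun _ _ _ _ => rfl
  have e₂ : ∀ (f : Fn) (j : Jet) w z, totX f ⟨j.x, j.y, j.u, j.ux, j.uy, w, z⟩ =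
    totX f j := fun _ _ _ _ => rfl
  have e₃ : ∀ (f : Fn) (j : Jet) w z, totY f ⟨j.x, j.y, j.u, j.ux, j.uy, w, z⟩ =
    totY f j := fun _ _ _ _ => rfl
  -- The two jets differ only in `u_{0,xx}`, which enters only through `- u_{0,xx} D_y ξ`; in
  -- particular both series are the same.
  have hY : ∀ j, totY v.cx j = 0 := by
    intro j
    have h1 := (hs 0 ⟨j.x, j.y, j.u, j.ux, j.uy, 0, 0⟩).unique
      (hs 0 ⟨j.x, j.y, j.u, j.ux, j.uy, Finsupp.single 0 1, 0⟩)
    simp only [prolongFree, Finsupp.coe_zero, Pi.zero_apply, zero_mul, Finsupp.single_eq_same,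
      one_mul, e₁, e₂, e₃] at h1
    linear_combination -h1
  have hX : ∀ j, totX v.cy j = 0 := by
    intro j
    have h1 := (hs 0 ⟨j.x, j.y, j.u, j.ux, j.uy, 0, 0⟩).unique
      (hs 0 ⟨j.x, j.y, j.u, j.ux, j.uy, 0, Finsupp.single 0 1⟩)
    simp only [prolongFree, Finsupp.coe_zero, Pi.zero_apply, zero_mul, Finsupp.single_eq_same,
      one_mul, e₁, e₂, e₃] at h1
    linear_combination -h1
  have hxY : ∀ x y u, dY v.cx x y u = 0 := fun x y u => by
    simpa [totY] using hY ⟨x, y, u, 0, 0, 0, 0⟩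
  have hyX : ∀ x y u, dX v.cy x y u = 0 := fun x y u => by
    simpa [totX] using hX ⟨x, y, u, 0, 0, 0, 0⟩
  have hxU : ∀ k x y u, dU k v.cx x y u = 0 := fun k x y u => by
    simpa [totY, hxY] using hY ⟨x, y, u, 0, Finsupp.single k 1, 0, 0⟩
  have hyU : ∀ k x y u, dU k v.cy x y u = 0 := fun k x y u => by
    simpa [totX, hyX] using hX ⟨x, y, u, Finsupp.single k 1, 0, 0, 0⟩
  have ex : v.cx = fun x _ _ => v.cx x 0 0 := by
    funext x y u
    rw [hcx.eq_of_dU_eq_zero (fun k u => hxU k x y u)]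
    exact is_const_of_deriv_eq_zero ((hcx.contDiff_y x 0).differentiable (by simp))
      (fun y => hxY x y 0) y 0
  have ey : v.cy = fun _ y _ => v.cy 0 y 0 := by
    funext x y u
    rw [hcy.eq_of_dU_eq_zero (fun k u => hyU k x y u)]
    exact is_const_of_deriv_eq_zero ((hcy.contDiff_x y 0).differentiable (by simp))
      (fun x => hyX x y 0) x 0
  -- Once `ξ = ξ(x)` and `η = η(y)`, the first derivatives `u_x`, `u_y` occur only in the free part
  -- of `D_x D_y φ_n`, which therefore cannot depend on them.
  have hfree : ∀ n x y u ux uy, totXYfree (v.cu n) ⟨x, y, u, ux, uy, 0, 0⟩ =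
      dX (dY (v.cu n)) x y u := by
    intro n x y u ux uy
    have h0 : ∀ ux uy, prolongExp H K v n ⟨x, y, u, ux, uy, 0, 0⟩ =
        totXYexp H K (v.cu n) ⟨x, y, u, 0, 0, 0, 0⟩ := by
      intro ux uy
      funext m
      rw [prolongExp, ex, ey]
      simp only [totXYexp, dU_x, dU_y, Pi.zero_apply, zero_mul, finsum_zero, mul_zero, sub_zero]
    have h1 := hs n ⟨x, y, u, ux, uy, 0, 0⟩
    have h2 := hs n ⟨x, y, u, 0, 0, 0, 0⟩
    rw [h0] at h1 h2
    have h3 := h1.unique h2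
    have a1 : ∀ j, totXYfree v.cx j = 0 := fun j => by
      rw [ex]; simp [totXYfree, dY_x, dX_zero, dX_x, dU_x, dU_zero]
    have a2 : ∀ j, totXYfree v.cy j = 0 := fun j => by
      rw [ey]; simp [totXYfree, dX_y, dY_y, dU_y, dU_zero]
    have a3 : ∀ j : Jet, totX v.cx j = deriv (fun x => v.cx x 0 0) j.x := fun j => by
      rw [ex]; simp [totX, dX_x, dU_x]
    have a4 : ∀ j : Jet, totY v.cy j = deriv (fun y => v.cy 0 y 0) j.y := fun j => by
      rw [ey]; simp [totY, dY_y, dU_y]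
    simp only [prolongFree, a1, a2, a3, a4, hX, hY] at h3
    have h4 : totXYfree (v.cu n) ⟨x, y, u, 0, 0, 0, 0⟩ = dX (dY (v.cu n)) x y u := by
      simp [totXYfree]
    rw [← h4]
    linear_combination -h3
  have hUY : ∀ n k x y u, dU k (dY (v.cu n)) x y u = 0 := fun n k x y u => by
    simpa [totXYfree] using hfree n x y u (Finsupp.single k 1) 0
  have hUX : ∀ n k x y u, dU k (dX (v.cu n)) x y u = 0 := fun n k x y u => by
    simpa [totXYfree] using hfree n x y u 0 (Finsupp.single k 1)
  have hUU : ∀ n k l x y u, dU k (dU l (v.cu n)) x y u = 0 := fun n k l x y u => by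
    simpa [totXYfree, hUX, hUY] using
      hfree n x y u (Finsupp.single k 1) (Finsupp.single l 1)
  refine ⟨fun x => v.cx x 0 0, fun y => v.cy 0 y 0, fun n x y => v.cu n x y 0,
    fun n k => dU k (v.cu n) 0 0 0, hcx.contDiff_x 0 0, hcy.contDiff_y 0 0,
    fun n => (hcu n).plane 0, ?_⟩
  refine Prod.ext ex (Prod.ext ey ?_)
  funext n x y u
  change v.cu n x y u = v.cu n x y 0 + linForm (fun k => dU k (v.cu n) 0 0 0) u
  -- The difference `φ_n(x, y, u) - φ_n(x, y, 0)` is moved to `x = 0`, then to `y = 0`, where it is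
  -- linear in `u`.
  have h1 := (hcu n).eq_of_dX_eq (y := y) (y' := y) (u := u) (u' := 0)
    (fun x => (hcu n).partialX.eq_of_dU_eq_zero (fun k u => hUX n k x y u) u) x 0
  have h2 := (hcu n).eq_of_dY_eq (x := 0) (x' := 0) (u := u) (u' := 0)
    (fun y => (hcu n).partialY.eq_of_dU_eq_zero (fun k u => hUY n k 0 y u) u) y 0
  have h3 := (hcu n).eq_of_deriv_line (x := 0) (y := 0) (c := fun k => dU k (v.cu n) 0 0 0)
    (fun k u => ((hcu n).partialU k).eq_of_dU_eq_zero (fun l u => hUU n l k 0 0 u) u) u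
  linarith

theorem isPointSymmetry_iff (hH : IsBand H p₁ p₂) (hK : IsBand K.transpose q₁ q₂) (v : VField) :
    IsPointSymmetry H K v ↔ ∃ (ξ η : ℝ → ℝ) (g : ℤ → ℝ → ℝ → ℝ) (A : ℤ → ℤ → ℝ),
      IsSymmetryData H K p₁ p₂ q₁ q₂ ξ η g A ∧ v = affineField ξ η g A := by
  constructor
  · intro h
    obtain ⟨ξ, η, g, A, hξ, hη, hg, rfl⟩ := h.exists_affineField
    exact ⟨ξ, η, g, A, isSymmetryData_of_isPointSymmetry hH hK hξ hη hg h, rfl⟩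
  · rintro ⟨ξ, η, g, A, h, rfl⟩
    exact h.isPointSymmetry hH hK

end

/-! ### The vector space of point symmetries -/

section

variable {H K : Matrix ℤ ℤ ℝ} {p₁ p₂ q₁ q₂ : ℤ}

theorem affineField_add (ξ ξ' η η' : ℝ → ℝ) (g g' : ℤ → ℝ → ℝ → ℝ) (A A' : ℤ → ℤ → ℝ) :
    affineField ξ η g A + affineField ξ' η' g' A' =
      affineField (ξ + ξ') (η + η') (g + g') (A + A') := by
  refine Prod.ext rfl (Prod.ext rfl ?_)
  funext n x y u
  change g n x y + linForm (A n) u + (g' n x y + linForm (A' n) u) =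
    g n x y + g' n x y + linForm (A n + A' n) u
  rw [linForm_add_left]
  ring

theorem smul_affineField (c : ℝ) (ξ η : ℝ → ℝ) (g : ℤ → ℝ → ℝ → ℝ) (A : ℤ → ℤ → ℝ) :
    c • affineField ξ η g A = affineField (c • ξ) (c • η) (c • g) (c • A) := by
  refine Prod.ext rfl (Prod.ext rfl ?_)
  funext n x y u
  change c * (g n x y + linForm (A n) u) = c * g n x y + linForm (c • A n) u
  rw [linForm_smul_left]
  ring

theorem affineField_zero : affineField 0 0 0 0 = 0 := by
  refine Prod.ext rfl (Prod.ext rfl ?_)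
  funext n x y u
  change (0 : ℝ) + linForm 0 u = 0
  simp

theorem IsSymmetryData.zero : IsSymmetryData H K p₁ p₂ q₁ q₂ 0 0 0 0 where
  contDiff_x := contDiff_const
  contDiff_y := contDiff_const
  contDiff_plane _ := contDiff_const
  split _ _ _ := by simp
  diffOp_plane m x y := by
    change diffOp H p₁ p₂ 0 m = -(deriv (fun _ => (0 : ℝ)) x + deriv (fun _ => (0 : ℝ)) y)
    simp
  diffOp_col _ := map_zero _
  diffOp_row _ := map_zero _

theorem IsSymmetryData.add {ξ ξ' η η' : ℝ → ℝ} {g g' : ℤ → ℝ → ℝ → ℝ} {A A' : ℤ → ℤ → ℝ}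
    (h : IsSymmetryData H K p₁ p₂ q₁ q₂ ξ η g A) (h' : IsSymmetryData H K p₁ p₂ q₁ q₂ ξ' η' g' A') :
    IsSymmetryData H K p₁ p₂ q₁ q₂ (ξ + ξ') (η + η') (g + g') (A + A') where
  contDiff_x := h.contDiff_x.add h'.contDiff_x
  contDiff_y := h.contDiff_y.add h'.contDiff_y
  contDiff_plane n := (h.contDiff_plane n).add (h'.contDiff_plane n)
  split n x y := by
    simp only [Pi.add_apply]
    rw [h.split n x y, h'.split n x y]
    ring
  diffOp_plane m x y := by
    change diffOp H p₁ p₂ ((fun n => g n x y) + fun n => g' n x y) m = _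
    rw [map_add, Pi.add_apply, h.diffOp_plane, h'.diffOp_plane,
      deriv_add (h.contDiff_x.differentiable (by simp) x) (h'.contDiff_x.differentiable (by simp) x),
      deriv_add (h.contDiff_y.differentiable (by simp) y) (h'.contDiff_y.differentiable (by simp) y)]
    ring
  diffOp_col k := by
    change diffOp H p₁ p₂ ((fun n => A n k) + fun n => A' n k) = 0
    rw [map_add, h.diffOp_col, h'.diffOp_col, add_zero]
  diffOp_row n := by
    rw [Pi.add_apply, map_add, h.diffOp_row, h'.diffOp_row, add_zero]

theorem IsSymmetryData.smul {ξ η : ℝ → ℝ} {g : ℤ → ℝ → ℝ → ℝ} {A : ℤ → ℤ → ℝ}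
    (h : IsSymmetryData H K p₁ p₂ q₁ q₂ ξ η g A) (c : ℝ) :
    IsSymmetryData H K p₁ p₂ q₁ q₂ (c • ξ) (c • η) (c • g) (c • A) where
  contDiff_x := contDiff_const.mul h.contDiff_x
  contDiff_y := contDiff_const.mul h.contDiff_y
  contDiff_plane n := contDiff_const.mul (h.contDiff_plane n)
  split n x y := by
    simp only [Pi.smul_apply, smul_eq_mul]
    rw [h.split n x y]
    ring
  diffOp_plane m x y := by
    change diffOp H p₁ p₂ (c • fun n => g n x y) m = _
    rw [map_smul, Pi.smul_apply, h.diffOp_plane,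
      deriv_const_smul c (h.contDiff_x.differentiable (by simp) x),
      deriv_const_smul c (h.contDiff_y.differentiable (by simp) y)]
    simp only [smul_eq_mul]
    ring
  diffOp_col k := by
    change diffOp H p₁ p₂ (c • fun n => A n k) = 0
    rw [map_smul, h.diffOp_col, smul_zero]
  diffOp_row n := by
    rw [Pi.smul_apply, map_smul, h.diffOp_row, smul_zero]

/-- The vector space of point symmetries. -/
def symmetrySpace (hH : IsBand H p₁ p₂) (hK : IsBand K.transpose q₁ q₂) : Submodule ℝ VField where
  carrier := {v | IsPointSymmetry H K v}
  zero_mem' := affineField_zero ▸ IsSymmetryData.zero.isPointSymmetry hH hK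
  add_mem' {v w} hv hw := by
    obtain ⟨ξ, η, g, A, h, rfl⟩ := (isPointSymmetry_iff hH hK v).1 hv
    obtain ⟨ξ', η', g', A', h', rfl⟩ := (isPointSymmetry_iff hH hK w).1 hw
    rw [affineField_add]
    exact (h.add h').isPointSymmetry hH hK
  smul_mem' c v hv := by
    obtain ⟨ξ, η, g, A, h, rfl⟩ := (isPointSymmetry_iff hH hK v).1 hv
    rw [smul_affineField]
    exact (h.smul c).isPointSymmetry hH hK

/-! ### Closure under commutators -/

theorem hasSum_iff_of_eq {f g : ℤ → ℝ} {c : ℝ} (h : ∀ k, f k = g k) : HasSum f c ↔ HasSum g c := by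
  rw [funext h]

theorem hasSum_diffOp {M : Matrix ℤ ℤ ℝ} {a b : ℤ} {T : ℤ → ℤ → ℝ} {S : ℤ → ℝ}
    (h : ∀ n, HasSum (T n) (S n)) (m : ℤ) :
    HasSum (fun k => diffOp M a b (fun n => T n k) m) (diffOp M a b S m) := by
  simp only [diffOp_eq_sum_Icc]
  exact hasSum_sum fun n _ => (h n).mul_left _

theorem diffOp_comb {M : Matrix ℤ ℤ ℝ} {a b : ℤ} {f h : ℤ → ℝ} (hf : diffOp M a b f = 0)
    (hh : diffOp M a b h = 0) (c d : ℝ) : diffOp M a b (fun n => c * f n - d * h n) = 0 := by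
  change diffOp M a b (c • f - d • h) = 0
  rw [map_sub, map_smul, map_smul, hf, hh]
  simp

/-- A difference operator involves finitely many entries at a time, so it may be applied to a
convergent series term by term. -/
theorem diffOp_eq_zero_of_hasSum {M : Matrix ℤ ℤ ℝ} {a b : ℤ} {T : ℤ → ℤ → ℝ} {S : ℤ → ℝ}
    (h : ∀ n, HasSum (T n) (S n)) (hT : ∀ k, diffOp M a b (fun n => T n k) = 0) :
    diffOp M a b S = 0 := by
  funext m
  have := hasSum_diffOp (M := M) (a := a) (b := b) h m
  simp only [hT, Pi.zero_apply] at this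
  exact this.unique hasSum_zero

theorem deriv_diffOp {M : Matrix ℤ ℤ ℝ} {a b : ℤ} {f : ℤ → ℝ → ℝ} (hf : ∀ n, Differentiable ℝ (f n))
    (m : ℤ) (t : ℝ) :
    diffOp M a b (fun n => deriv (f n) t) m = deriv (fun t => diffOp M a b (fun n => f n t) m) t := by
  simp only [diffOp_eq_sum_Icc]
  rw [deriv_fun_sum fun n _ => (hf n t).const_mul _]
  exact Finset.sum_congr rfl fun n _ => (deriv_const_mul _ (hf n t)).symm

namespace IsSymmetryData

variable {ξ η : ℝ → ℝ} {g : ℤ → ℝ → ℝ → ℝ} {A : ℤ → ℤ → ℝ}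

theorem deriv_plane_x (h : IsSymmetryData H K p₁ p₂ q₁ q₂ ξ η g A) (n : ℤ) (x y : ℝ) :
    deriv (fun t => g n t y) x = deriv (fun t => g n t 0) x := by
  have : (fun t => g n t y) = fun t => g n t 0 + (g n 0 y - g n 0 0) := by
    funext t
    rw [h.split]
    ring
  rw [this, deriv_add_const]

theorem deriv_plane_y (h : IsSymmetryData H K p₁ p₂ q₁ q₂ ξ η g A) (n : ℤ) (x y : ℝ) :
    deriv (g n x) y = deriv (g n 0) y := by
  have : g n x = fun t => (g n x 0 - g n 0 0) + g n 0 t := by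
    funext t
    rw [h.split]
    ring
  rw [this, deriv_const_add]

theorem diffOp_deriv_x (h : IsSymmetryData H K p₁ p₂ q₁ q₂ ξ η g A) (m : ℤ) (x : ℝ) :
    diffOp H p₁ p₂ (fun n => deriv (fun t => g n t 0) x) m = -deriv (deriv ξ) x := by
  rw [deriv_diffOp (f := fun n t => g n t 0) fun n => ((h.contDiff_plane n).comp
    (contDiff_id.prodMk contDiff_const)).differentiable (by simp)]
  simp only [h.diffOp_plane]
  rw [deriv.fun_neg, deriv_add_const]

theorem diffOp_deriv_y (h : IsSymmetryData H K p₁ p₂ q₁ q₂ ξ η g A) (m : ℤ) (y : ℝ) :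
    diffOp H p₁ p₂ (fun n => deriv (g n 0) y) m = -deriv (deriv η) y := by
  rw [deriv_diffOp (f := fun n t => g n 0 t) fun n => ((h.contDiff_plane n).comp
    (contDiff_const.prodMk contDiff_id)).differentiable (by simp)]
  simp only [h.diffOp_plane]
  rw [deriv.fun_neg, deriv_const_add]

end IsSymmetryData

theorem deriv_wronskian {f h : ℝ → ℝ} (hf : ContDiff ℝ ∞ f) (hh : ContDiff ℝ ∞ h) (t : ℝ) :
    deriv (fun t => f t * deriv h t - h t * deriv f t) t =
      f t * deriv (deriv h) t - h t * deriv (deriv f) t := by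
  have d : ∀ {k : ℝ → ℝ}, ContDiff ℝ ∞ k → HasDerivAt k (deriv k t) t := fun hk =>
    (hk.differentiable (by simp) t).hasDerivAt
  have d2 : ∀ {k : ℝ → ℝ}, ContDiff ℝ ∞ k → HasDerivAt (deriv k) (deriv (deriv k) t) t :=
    fun hk => d (contDiff_infty_iff_deriv.1 hk).2
  have key : HasDerivAt (fun t => f t * deriv h t - h t * deriv f t) _ t :=
    ((d hf).mul (d2 hh)).sub ((d hh).mul (d2 hf))
  rw [key.deriv]
  ring

theorem isPointSymmetry_of_isBracket (hH : IsBand H p₁ p₂) (hK : IsBand K.transpose q₁ q₂)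
    {v w z : VField} (hv : IsPointSymmetry H K v) (hw : IsPointSymmetry H K w) (hz : z.Smooth)
    (hb : IsBracket v w z) : IsPointSymmetry H K z := by
  obtain ⟨ξ, η, g, A, h, rfl⟩ := (isPointSymmetry_iff hH hK v).1 hv
  obtain ⟨ξ', η', g', A', h', rfl⟩ := (isPointSymmetry_iff hH hK w).1 hw
  obtain ⟨hbx, hby, hbu⟩ := hb
  have ex : ∀ x y u, z.cx x y u = ξ x * deriv ξ' x - ξ' x * deriv ξ x := by
    intro x y u
    have h1 := hbx x y u
    simp only [affineField_cx, affineField_cy, dU_x, dX_x, dY_x, Pi.zero_apply, mul_zero,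
      sub_zero, add_zero] at h1
    exact sub_eq_zero.1 (h1.unique hasSum_zero)
  have ey : ∀ x y u, z.cy x y u = η y * deriv η' y - η' y * deriv η y := by
    intro x y u
    have h1 := hby x y u
    simp only [affineField_cx, affineField_cy, dU_y, dX_y, dY_y, Pi.zero_apply, mul_zero,
      sub_zero, zero_add] at h1
    exact sub_eq_zero.1 (h1.unique hasSum_zero)
  -- The part of the bracket coming from the `x`- and `y`-derivatives. By the splitting of `g` and
  -- `g'` it is a function of `x` plus a function of `y`.
  let D : ℤ → ℝ → ℝ → ℝ := fun n x y =>
    ξ x * deriv (fun t => g' n t 0) x + η y * deriv (g' n 0) y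
      - ξ' x * deriv (fun t => g n t 0) x - η' y * deriv (g n 0) y
  have eu : ∀ n x y u, HasSum (fun k => (g k x y + linForm (A k) u) * A' n k -
      (g' k x y + linForm (A' k) u) * A n k) (z.cu n x y u - D n x y) := by
    intro n x y u
    have h1 := hbu n x y u
    simp only [affineField_cx, affineField_cy, affineField_cu, dU_affine, dX_affine, dY_affine,
      h.deriv_plane_x n x y, h'.deriv_plane_x n x y, h.deriv_plane_y n x y,
      h'.deriv_plane_y n x y] at h1
    exact h1
  have elin : ∀ n u, HasSum (fun k => linForm (A k) u * A' n k - linForm (A' k) u * A n k)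
      (z.cu n 0 0 u - z.cu n 0 0 0) := by
    intro n u
    have h1 := (eu n 0 0 u).sub (eu n 0 0 0)
    rw [sub_sub_sub_cancel_right] at h1
    exact (hasSum_iff_of_eq fun k => by simp only [map_zero]; ring).1 h1
  -- The matrix `A'A - AA'`. Only the series of differences is known to converge, not the two
  -- products separately.
  let Q : ℤ → ℤ → ℝ := fun n l => z.cu n 0 0 (Finsupp.single l 1) - z.cu n 0 0 0
  have eQ : ∀ n l, HasSum (fun k => A k l * A' n k - A' k l * A n k) (Q n l) := by
    intro n l
    simpa using elin n (Finsupp.single l 1)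
  have hlin : ∀ n u, z.cu n 0 0 u - z.cu n 0 0 0 = linForm (Q n) u := by
    intro n u
    refine (elin n u).unique ?_
    rw [linForm_eq_sum (Q n) subset_rfl]
    refine (hasSum_iff_of_eq fun k => ?_).2
      (hasSum_sum (s := u.support) fun l _ => (eQ n l).mul_left (u l))
    rw [linForm_eq_sum _ subset_rfl, linForm_eq_sum _ subset_rfl, Finset.sum_mul, Finset.sum_mul,
      ← Finset.sum_sub_distrib]
    exact Finset.sum_congr rfl fun l _ => by ring
  have hu : ∀ n x y u, z.cu n x y u = z.cu n x y 0 + linForm (Q n) u := by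
    intro n x y u
    rw [← hlin]
    have h1 := (eu n x y 0).add (elin n u)
    have h2 := h1.unique ((hasSum_iff_of_eq fun k => by simp only [map_zero]; ring).1 (eu n x y u))
    linarith
  have hz' : z = affineField (fun x => ξ x * deriv ξ' x - ξ' x * deriv ξ x)
      (fun y => η y * deriv η' y - η' y * deriv η y) (fun n x y => z.cu n x y 0) Q := by
    refine Prod.ext ?_ (Prod.ext ?_ ?_)
    · funext x y u
      exact ex x y u
    · funext x y u
      exact ey x y u
    · funext n x y u
      exact hu n x y u
  rw [hz']
  refine IsSymmetryData.isPointSymmetry hH hK ⟨?_, ?_, fun n => (hz.2.2 n).plane 0, ?_, ?_, ?_, ?_⟩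
  · simpa only [ex] using hz.1.contDiff_x 0 0
  · simpa only [ey] using hz.2.1.contDiff_y 0 0
  · intro n x y
    -- The terms of the series split in `x` and `y` because `g` and `g'` do.
    have h1 := ((eu n x 0 0).add (eu n 0 y 0)).sub (eu n 0 0 0)
    have h2 := h1.unique ((hasSum_iff_of_eq fun k => by
      rw [h.split k x y, h'.split k x y]
      ring).1 (eu n x y 0))
    simp only [D] at h2
    linarith
  · intro m x y
    have h1 : diffOp H p₁ p₂ (fun n => z.cu n x y 0 - D n x y) = 0 :=
      diffOp_eq_zero_of_hasSum (fun n => eu n x y 0)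
        fun k => diffOp_comb (h'.diffOp_col k) (h.diffOp_col k) _ _
    have h2 : diffOp H p₁ p₂ (fun n => D n x y) m = ξ x * -deriv (deriv ξ') x +
        η y * -deriv (deriv η') y - ξ' x * -deriv (deriv ξ) x - η' y * -deriv (deriv η) y := by
      rw [← h'.diffOp_deriv_x m, ← h'.diffOp_deriv_y m, ← h.diffOp_deriv_x m, ← h.diffOp_deriv_y m]
      change diffOp H p₁ p₂ (ξ x • (fun n => deriv (fun t => g' n t 0) x) +
        η y • (fun n => deriv (g' n 0) y) - ξ' x • (fun n => deriv (fun t => g n t 0) x) -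
        η' y • (fun n => deriv (g n 0) y)) m = _
      simp only [map_sub, map_add, map_smul, Pi.sub_apply, Pi.add_apply, Pi.smul_apply, smul_eq_mul]
    have h3 : (fun n => z.cu n x y 0) = (fun n => z.cu n x y 0 - D n x y) + fun n => D n x y := by
      funext n
      simp
    rw [h3, map_add, Pi.add_apply, h1, h2, deriv_wronskian h.contDiff_x h'.contDiff_x,
      deriv_wronskian h.contDiff_y h'.contDiff_y, Pi.zero_apply]
    ring
  · intro l
    -- The columns of `Q` are series in columns of `A` and `A'`; below, its rows are series in their
    -- rows.
    exact diffOp_eq_zero_of_hasSum (fun n => eQ n l)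
      fun k => diffOp_comb (h'.diffOp_col k) (h.diffOp_col k) _ _
  · intro n
    refine diffOp_eq_zero_of_hasSum (fun l => eQ n l) fun k => ?_
    convert diffOp_comb (h.diffOp_row k) (h'.diffOp_row k) (A' n k) (A n k) using 3
    ring

/-! ### The generators -/

theorem fieldX_eq (b : ℤ → ℝ) (ξ : ℝ → ℝ) :
    fieldX b ξ = affineField ξ 0 (fun n x _ => -(deriv ξ x * b n)) 0 := by
  refine Prod.ext rfl (Prod.ext rfl ?_)
  funext n x y u
  exact (add_eq_left.2 (linForm_zero_left u)).symm

theorem fieldY_eq (b : ℤ → ℝ) (η : ℝ → ℝ) :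
    fieldY b η = affineField 0 η (fun n _ y => -(deriv η y * b n)) 0 := by
  refine Prod.ext rfl (Prod.ext rfl ?_)
  funext n x y u
  exact (add_eq_left.2 (linForm_zero_left u)).symm

theorem fieldU_eq (ψ : ℤ → ℝ) (r : ℝ → ℝ) :
    fieldU ψ r = affineField 0 0 (fun n x _ => r x * ψ n) 0 := by
  refine Prod.ext rfl (Prod.ext rfl ?_)
  funext n x y u
  exact (add_eq_left.2 (linForm_zero_left u)).symm

theorem fieldV_eq (ψ : ℤ → ℝ) (s : ℝ → ℝ) :
    fieldV ψ s = affineField 0 0 (fun n _ y => s y * ψ n) 0 := by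
  refine Prod.ext rfl (Prod.ext rfl ?_)
  funext n x y u
  exact (add_eq_left.2 (linForm_zero_left u)).symm

theorem fieldZ_eq (φ ψ : ℤ → ℝ) :
    fieldZ φ ψ = affineField 0 0 0 (fun n => ψ n • φ) := by
  refine Prod.ext rfl (Prod.ext rfl ?_)
  funext n x y u
  change (u.sum fun m a => φ m * a) * ψ n = 0 + linForm (ψ n • φ) u
  rw [linForm_smul_left, linForm_apply]
  ring

theorem diffOp_mul_left (M : Matrix ℤ ℤ ℝ) (a b : ℤ) (c : ℝ) (f : ℤ → ℝ) (m : ℤ) :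
    diffOp M a b (fun n => c * f n) m = c * diffOp M a b f m := by
  change diffOp M a b (c • f) m = _
  rw [map_smul]
  rfl

theorem isPointSymmetry_fieldX (hH : IsBand H p₁ p₂) (hK : IsBand K.transpose q₁ q₂) {b : ℤ → ℝ}
    (hb : diffOp H p₁ p₂ b = 1) {ξ : ℝ → ℝ} (hξ : ContDiff ℝ ∞ ξ) :
    IsPointSymmetry H K (fieldX b ξ) := by
  rw [fieldX_eq]
  refine IsSymmetryData.isPointSymmetry hH hK ⟨hξ, contDiff_const, fun n => ?_, by simp, ?_,
    fun _ => map_zero _, fun _ => map_zero _⟩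
  · exact (((contDiff_infty_iff_deriv.1 hξ).2.comp contDiff_fst).mul contDiff_const).neg
  · intro m x y
    simp only [← neg_mul]
    rw [diffOp_mul_left, hb]
    change _ = -(deriv ξ x + deriv (fun _ => 0) y)
    simp

theorem isPointSymmetry_fieldY (hH : IsBand H p₁ p₂) (hK : IsBand K.transpose q₁ q₂) {b : ℤ → ℝ}
    (hb : diffOp H p₁ p₂ b = 1) {η : ℝ → ℝ} (hη : ContDiff ℝ ∞ η) :
    IsPointSymmetry H K (fieldY b η) := by
  rw [fieldY_eq]
  refine IsSymmetryData.isPointSymmetry hH hK ⟨contDiff_const, hη, fun n => ?_, by simp, ?_,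
    fun _ => map_zero _, fun _ => map_zero _⟩
  · exact (((contDiff_infty_iff_deriv.1 hη).2.comp contDiff_snd).mul contDiff_const).neg
  · intro m x y
    simp only [← neg_mul]
    rw [diffOp_mul_left, hb]
    change _ = -(deriv (fun _ => 0) x + deriv η y)
    simp

theorem isPointSymmetry_fieldU (hH : IsBand H p₁ p₂) (hK : IsBand K.transpose q₁ q₂) {ψ : ℤ → ℝ}
    (hψ : diffOp H p₁ p₂ ψ = 0) {r : ℝ → ℝ} (hr : ContDiff ℝ ∞ r) :
    IsPointSymmetry H K (fieldU ψ r) := by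
  rw [fieldU_eq]
  refine IsSymmetryData.isPointSymmetry hH hK ⟨contDiff_const, contDiff_const, fun n => ?_,
    by simp, ?_, fun _ => map_zero _, fun _ => map_zero _⟩
  · exact (hr.comp contDiff_fst).mul contDiff_const
  · intro m x y
    rw [diffOp_mul_left, hψ]
    change _ = -(deriv (fun _ => 0) x + deriv (fun _ => 0) y)
    simp

theorem isPointSymmetry_fieldV (hH : IsBand H p₁ p₂) (hK : IsBand K.transpose q₁ q₂) {ψ : ℤ → ℝ}
    (hψ : diffOp H p₁ p₂ ψ = 0) {s : ℝ → ℝ} (hs : ContDiff ℝ ∞ s) :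
    IsPointSymmetry H K (fieldV ψ s) := by
  rw [fieldV_eq]
  refine IsSymmetryData.isPointSymmetry hH hK ⟨contDiff_const, contDiff_const, fun n => ?_,
    by simp, ?_, fun _ => map_zero _, fun _ => map_zero _⟩
  · exact (hs.comp contDiff_snd).mul contDiff_const
  · intro m x y
    rw [diffOp_mul_left, hψ]
    change _ = -(deriv (fun _ => 0) x + deriv (fun _ => 0) y)
    simp

theorem isPointSymmetry_fieldZ (hH : IsBand H p₁ p₂) (hK : IsBand K.transpose q₁ q₂) {φ ψ : ℤ → ℝ}
    (hφ : diffOp K.transpose q₁ q₂ φ = 0) (hψ : diffOp H p₁ p₂ ψ = 0) :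
    IsPointSymmetry H K (fieldZ φ ψ) := by
  rw [fieldZ_eq]
  refine IsSymmetryData.isPointSymmetry hH hK { IsSymmetryData.zero (H := H) (K := K) (p₁ := p₁)
    (p₂ := p₂) (q₁ := q₁) (q₂ := q₂) with
    diffOp_col := fun k => ?_
    diffOp_row := fun n => ?_ }
  · funext m
    have : (fun n => (ψ n • φ) k) = fun n => φ k * ψ n := by
      funext n
      exact mul_comm _ _
    rw [this, diffOp_mul_left, hψ]
    simp
  · rw [map_smul, hφ, smul_zero]

/-! ### Decomposition into generators and its uniqueness -/

theorem combination_eq {d e : ℕ} (b : ℤ → ℝ) (ψ : Fin d → ℤ → ℝ) (φ : Fin e → ℤ → ℝ)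
    (ξ η : ℝ → ℝ) (r s : Fin d → ℝ → ℝ) (q : Fin d → Fin e → ℝ) :
    combination b ψ φ ξ η r s q = affineField ξ η
      (fun n x y => -(deriv ξ x + deriv η y) * b n + ∑ j, (r j x + s j y) * ψ j n)
      (fun n m => ∑ j, (∑ l, q j l * φ l m) * ψ j n) := by
  refine Prod.ext ?_ (Prod.ext ?_ ?_)
  · funext x y u
    simp [combination, fieldX, fieldY, fieldU, fieldV, fieldZ, affineField, Prod.fst_sum]
  · funext x y u
    simp [combination, fieldX, fieldY, fieldU, fieldV, fieldZ, affineField, Prod.fst_sum,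
      Prod.snd_sum]
  · funext n x y u
    have hl : linForm (fun m => ∑ j, (∑ l, q j l * φ l m) * ψ j n) u =
        ∑ j, ∑ l, q j l * (linForm (φ l) u * ψ j n) := by
      simp only [linForm_eq_sum _ subset_rfl, Finset.mul_sum, Finset.sum_mul]
      rw [Finset.sum_comm]
      refine Finset.sum_congr rfl fun j _ => ?_
      rw [Finset.sum_comm]
      exact Finset.sum_congr rfl fun l _ => Finset.sum_congr rfl fun k _ => by ring
    simp only [combination, fieldX, fieldY, fieldU, fieldV, fieldZ, affineField, Prod.snd_add,
      Prod.snd_sum, Prod.smul_snd, Pi.add_apply, Finset.sum_apply, Pi.smul_apply, smul_eq_mul, hl,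
      ← linForm_apply, add_mul, Finset.sum_add_distrib]
    ring

variable {d e : ℕ} (ψ : Module.Basis (Fin d) ℝ (LinearMap.ker (diffOp H p₁ p₂)))
  (φ : Module.Basis (Fin e) ℝ (LinearMap.ker (diffOp K.transpose q₁ q₂)))

theorem sum_repr_mul {M : Matrix ℤ ℤ ℝ} {a b : ℤ}
    (ψ : Module.Basis (Fin d) ℝ (LinearMap.ker (diffOp M a b)))
    (f : LinearMap.ker (diffOp M a b)) (n : ℤ) : ∑ j, ψ.repr f j * (ψ j).1 n = f.1 n := by
  conv_rhs => rw [← ψ.sum_repr f]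
  simp [-Module.Basis.sum_repr]

theorem coeff_eq_zero {M : Matrix ℤ ℤ ℝ} {a b : ℤ}
    (ψ : Module.Basis (Fin d) ℝ (LinearMap.ker (diffOp M a b))) {c : Fin d → ℝ}
    (h : ∀ n, ∑ j, c j * (ψ j).1 n = 0) (j : Fin d) : c j = 0 := by
  refine Fintype.linearIndependent_iff.1 ψ.linearIndependent c ?_ j
  refine Subtype.ext (funext fun n => ?_)
  simpa using h n

theorem IsSymmetryData.exists_combination (hH : IsBand H p₁ p₂) {ξ η : ℝ → ℝ} {g : ℤ → ℝ → ℝ → ℝ}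
    {A : ℤ → ℤ → ℝ} (h : IsSymmetryData H K p₁ p₂ q₁ q₂ ξ η g A) {b : ℤ → ℝ}
    (hb : diffOp H p₁ p₂ b = 1) :
    ∃ (r s : Fin d → ℝ → ℝ) (q : Fin d → Fin e → ℝ), (∀ j, ContDiff ℝ ∞ (r j)) ∧
      (∀ j, ContDiff ℝ ∞ (s j)) ∧ affineField ξ η g A =
        combination b (fun j => (ψ j).1) (fun l => (φ l).1) ξ η r s q := by
  have hdξ : ContDiff ℝ ∞ (deriv ξ) := (contDiff_infty_iff_deriv.1 h.contDiff_x).2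
  have hdη : ContDiff ℝ ∞ (deriv η) := (contDiff_infty_iff_deriv.1 h.contDiff_y).2
  -- `X` and `Y` split `g(x, y) + (ξ'(x) + η'(y)) b`, which lies in `ker H`, into a function of `x`
  -- and a function of `y` with values in `ker H`. The choice `Y 0 = 0` fixes the free constants
  -- `c_j`.
  let X : ℝ → LinearMap.ker (diffOp H p₁ p₂) := fun x =>
    ⟨(fun n => g n x 0) + (deriv ξ x + deriv η 0) • b, by
      rw [LinearMap.mem_ker]
      funext m
      rw [map_add, map_smul, hb, Pi.add_apply, h.diffOp_plane]
      simp⟩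
  let Y : ℝ → LinearMap.ker (diffOp H p₁ p₂) := fun y =>
    ⟨(fun n => g n 0 y) - (fun n => g n 0 0) + (deriv η y - deriv η 0) • b, by
      rw [LinearMap.mem_ker]
      funext m
      rw [map_add, map_sub, map_smul, hb, Pi.add_apply, Pi.sub_apply, h.diffOp_plane,
        h.diffOp_plane]
      simp⟩
  let col : ℤ → LinearMap.ker (diffOp H p₁ p₂) := fun k => ⟨fun n => A n k, h.diffOp_col k⟩
  -- The columns of `A` are expanded in the `ψ^j`. As the rows of `A` solve the equation of `Kᵀ` and
  -- the `ψ^j` are independent, each sequence of coordinates solves it too.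
  let C : Fin d → LinearMap.ker (diffOp K.transpose q₁ q₂) := fun j =>
    ⟨fun k => ψ.repr (col k) j, by
      rw [LinearMap.mem_ker]
      funext m
      refine coeff_eq_zero ψ (c := fun j => diffOp K.transpose q₁ q₂
        (fun k => ψ.repr (col k) j) m) (fun n => ?_) j
      have h1 := congrFun (h.diffOp_row n) m
      rw [diffOp_eq_sum_Icc] at h1
      rw [Pi.zero_apply] at h1
      rw [← h1]
      simp only [diffOp_eq_sum_Icc, Finset.sum_mul]
      rw [Finset.sum_comm]
      refine Finset.sum_congr rfl fun k _ => ?_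
      have h2 : ∑ j, ψ.repr (col k) j * (ψ j).1 n = A n k := sum_repr_mul ψ (col k) n
      rw [← h2, Finset.mul_sum]
      exact Finset.sum_congr rfl fun j _ => by ring⟩
  refine ⟨fun j x => ψ.repr (X x) j, fun j y => ψ.repr (Y y) j, fun j l => φ.repr (C j) l,
    fun j => ?_, fun j => ?_, ?_⟩
  · refine hH.contDiff_of_ker X (fun n => ?_) (ψ.coord j)
    exact ((h.contDiff_plane n).comp (contDiff_id.prodMk contDiff_const)).add
      ((hdξ.add contDiff_const).mul contDiff_const)
  · refine hH.contDiff_of_ker Y (fun n => ?_) (ψ.coord j)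
    exact (((h.contDiff_plane n).comp (contDiff_const.prodMk contDiff_id)).sub contDiff_const).add
      ((hdη.sub contDiff_const).mul contDiff_const)
  · rw [combination_eq]
    congr 1
    · funext n x y
      simp only [add_mul (ψ.repr _ _), Finset.sum_add_distrib]
      rw [sum_repr_mul, sum_repr_mul]
      change g n x y = -(deriv ξ x + deriv η y) * b n +
        (g n x 0 + (deriv ξ x + deriv η 0) * b n +
        (g n 0 y - g n 0 0 + (deriv η y - deriv η 0) * b n))
      rw [h.split n x y]
      ring
    · funext n m
      simp only [sum_repr_mul φ]
      exact (sum_repr_mul ψ (col m) n).symm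

theorem combination_eq_zero_iff (b : ℤ → ℝ) (ξ η : ℝ → ℝ) (r s : Fin d → ℝ → ℝ)
    (q : Fin d → Fin e → ℝ) :
    combination b (fun j => (ψ j).1) (fun l => (φ l).1) ξ η r s q = 0 ↔
      ξ = 0 ∧ η = 0 ∧ q = 0 ∧ ∀ j, ∃ c : ℝ, (∀ t, r j t = c) ∧ (∀ t, s j t = -c) := by
  have hd : ∀ t : ℝ, deriv (0 : ℝ → ℝ) t = 0 := fun t => deriv_const t 0
  rw [combination_eq]
  constructor
  · intro h
    have hξ : ξ = 0 := funext fun x => congrFun (congrFun (congrFun (congrArg Prod.fst h) x) 0) 0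
    have hη : η = 0 := funext fun y =>
      congrFun (congrFun (congrFun (congrArg (fun v : VField => v.cy) h) 0) y) 0
    subst hξ hη
    have hu : ∀ n x y u, ∑ j, (r j x + s j y) * (ψ j).1 n +
        linForm (fun m => ∑ j, (∑ l, q j l * (φ l).1 m) * (ψ j).1 n) u = 0 := by
      intro n x y u
      have h1 := congrFun (congrFun (congrFun (congrArg (fun v : VField => v.cu n) h) x) y) u
      change _ = (0 : ℝ) at h1
      simpa only [affineField_cu, hd, add_zero, neg_zero, zero_mul, zero_add] using h1
    -- A function of `x` and a function of `y` with sum zero are opposite constants; this is the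
    -- relation `U_j(1) = V_j(1)`.
    have hrs : ∀ j x y, r j x + s j y = 0 := fun j x y =>
      coeff_eq_zero ψ (c := fun j => r j x + s j y) (fun n => by simpa using hu n x y 0) j
    refine ⟨rfl, rfl, ?_, fun j => ⟨r j 0, fun t => ?_, fun t => ?_⟩⟩
    · funext j l
      refine coeff_eq_zero φ (c := q j) (fun m => ?_) l
      refine coeff_eq_zero ψ (c := fun j => ∑ l, q j l * (φ l).1 m) (fun n => ?_) j
      simpa [hrs] using hu n 0 0 (Finsupp.single m 1)
    · linarith [hrs j t 0, hrs j 0 0]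
    · linarith [hrs j 0 t]
  · rintro ⟨rfl, rfl, rfl, hrs⟩
    rw [← affineField_zero]
    congr 1
    · funext n x y
      have : ∀ j, r j x + s j y = 0 := fun j => by
        obtain ⟨c, h1, h2⟩ := hrs j
        rw [h1, h2, add_neg_cancel]
      simp [this, hd]
    · funext n m
      simp

/-- The fields `X(ξ)` with polynomial `ξ` suffice; they exist even if both kernels are trivial. -/
theorem not_finiteDimensional_symmetrySpace (hH : IsBand H p₁ p₂)
    (hK : IsBand K.transpose q₁ q₂) {b : ℤ → ℝ} (hb : diffOp H p₁ p₂ b = 1) :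
    ¬ FiniteDimensional ℝ (symmetrySpace hH hK) := by
  intro hfin
  have hsm : ∀ p : Polynomial ℝ, ContDiff ℝ ∞ fun x => p.eval x := fun p => by
    simpa using p.contDiff_aeval (R := ℝ) (𝕜 := ℝ) ∞
  let F : Polynomial ℝ →ₗ[ℝ] symmetrySpace hH hK :=
    { toFun p := ⟨fieldX b fun x => p.eval x, isPointSymmetry_fieldX hH hK hb (hsm p)⟩
      map_add' p p' := by
        refine Subtype.ext (Prod.ext ?_ (Prod.ext ?_ ?_))
        · funext x y u
          exact Polynomial.eval_add
        · funext x y u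
          exact (add_zero (0 : ℝ)).symm
        · funext n x y u
          change -(deriv (fun x => (p + p').eval x) x * b n) =
            -(deriv (fun x => p.eval x) x * b n) + -(deriv (fun x => p'.eval x) x * b n)
          rw [Polynomial.deriv, Polynomial.deriv, Polynomial.deriv, Polynomial.derivative_add,
            Polynomial.eval_add]
          ring
      map_smul' c p := by
        refine Subtype.ext (Prod.ext ?_ (Prod.ext ?_ ?_))
        · funext x y u
          exact Polynomial.eval_smul ..
        · funext x y u
          exact (mul_zero c).symm
        · funext n x y u
          change -(deriv (fun x => (c • p).eval x) x * b n) =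
            c * -(deriv (fun x => p.eval x) x * b n)
          rw [Polynomial.deriv, Polynomial.deriv, Polynomial.derivative_smul, Polynomial.eval_smul,
            smul_eq_mul]
          ring }
  have hF : Function.Injective F := by
    intro p p' h
    refine Polynomial.funext fun x => ?_
    exact congrFun (congrFun (congrFun (congrArg (fun v => v.1.cx) h) x) 0) 0
  exact Polynomial.not_finite (R := ℝ) (Module.Finite.of_injective F hF)

end

end

end GenToda

/-! ### The classification theorem -/

theorem theorem1 (H K : Matrix ℤ ℤ ℝ) (p₁ p₂ q₁ q₂ : ℤ)
    (hH : GenToda.IsBand H p₁ p₂) (hK : GenToda.IsBand K.transpose q₁ q₂) :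
    -- the three difference equations have solutions as many as claimed
    Nonempty (Module.Basis (Fin (p₂ - p₁).toNat) ℝ (LinearMap.ker (GenToda.diffOp H p₁ p₂))) ∧
    Nonempty (Module.Basis (Fin (q₂ - q₁).toNat) ℝ
      (LinearMap.ker (GenToda.diffOp K.transpose q₁ q₂))) ∧
    (∃ b : ℤ → ℝ, GenToda.diffOp H p₁ p₂ b = 1) ∧
    -- the point symmetries form an infinite-dimensional space, closed under commutators
    ∃ 𝔤 : Submodule ℝ GenToda.VField,
      (∀ v : GenToda.VField, v ∈ 𝔤 ↔ GenToda.IsPointSymmetry H K v) ∧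
      ¬ FiniteDimensional ℝ 𝔤 ∧
      (∀ v ∈ 𝔤, ∀ w ∈ 𝔤, ∀ z : GenToda.VField, z.Smooth → GenToda.IsBracket v w z → z ∈ 𝔤) ∧
      -- for any choice of the solutions, the generators form a basis
      ∀ (ψ : Module.Basis (Fin (p₂ - p₁).toNat) ℝ (LinearMap.ker (GenToda.diffOp H p₁ p₂)))
        (φ : Module.Basis (Fin (q₂ - q₁).toNat) ℝ
          (LinearMap.ker (GenToda.diffOp K.transpose q₁ q₂)))
        (b : ℤ → ℝ), GenToda.diffOp H p₁ p₂ b = 1 →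
        -- they are symmetries
        (∀ ξ : ℝ → ℝ, ContDiff ℝ (⊤ : ℕ∞) ξ → GenToda.fieldX b ξ ∈ 𝔤) ∧
        (∀ η : ℝ → ℝ, ContDiff ℝ (⊤ : ℕ∞) η → GenToda.fieldY b η ∈ 𝔤) ∧
        (∀ (j : Fin (p₂ - p₁).toNat) (r : ℝ → ℝ), ContDiff ℝ (⊤ : ℕ∞) r →
          GenToda.fieldU (ψ j).1 r ∈ 𝔤) ∧
        (∀ (j : Fin (p₂ - p₁).toNat) (s : ℝ → ℝ), ContDiff ℝ (⊤ : ℕ∞) s →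
          GenToda.fieldV (ψ j).1 s ∈ 𝔤) ∧
        (∀ (j : Fin (p₂ - p₁).toNat) (l : Fin (q₂ - q₁).toNat),
          GenToda.fieldZ (φ l).1 (ψ j).1 ∈ 𝔤) ∧
        -- every symmetry is a combination of them
        (∀ v ∈ 𝔤, ∃ (ξ η : ℝ → ℝ) (r s : Fin (p₂ - p₁).toNat → ℝ → ℝ)
          (q : Fin (p₂ - p₁).toNat → Fin (q₂ - q₁).toNat → ℝ),
          ContDiff ℝ (⊤ : ℕ∞) ξ ∧ ContDiff ℝ (⊤ : ℕ∞) η ∧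
          (∀ j, ContDiff ℝ (⊤ : ℕ∞) (r j)) ∧ (∀ j, ContDiff ℝ (⊤ : ℕ∞) (s j)) ∧
          v = GenToda.combination b (fun j => (ψ j).1) (fun l => (φ l).1) ξ η r s q) ∧
        -- the combination is unique, up to the relation `U_j(1) = V_j(1)`
        (∀ (ξ η : ℝ → ℝ) (r s : Fin (p₂ - p₁).toNat → ℝ → ℝ)
          (q : Fin (p₂ - p₁).toNat → Fin (q₂ - q₁).toNat → ℝ),
          GenToda.combination b (fun j => (ψ j).1) (fun l => (φ l).1) ξ η r s q = 0 ↔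
            ξ = 0 ∧ η = 0 ∧ q = 0 ∧
              ∀ j, ∃ c : ℝ, (∀ t, r j t = c) ∧ (∀ t, s j t = -c)) := by
  have hb := hH.diffOp_bandSolution 1 0
  refine ⟨⟨Module.Basis.ofEquivFun hH.windowEquiv⟩, ⟨Module.Basis.ofEquivFun hK.windowEquiv⟩,
    ⟨_, hb⟩, GenToda.symmetrySpace hH hK, fun _ => Iff.rfl,
    GenToda.not_finiteDimensional_symmetrySpace hH hK hb,
    fun v hv w hw z hz h => GenToda.isPointSymmetry_of_isBracket hH hK hv hw hz h,
    fun ψ φ b hb => ⟨fun ξ hξ => GenToda.isPointSymmetry_fieldX hH hK hb hξ,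
      fun η hη => GenToda.isPointSymmetry_fieldY hH hK hb hη,
      fun j r hr => GenToda.isPointSymmetry_fieldU hH hK (ψ j).2 hr,
      fun j s hs => GenToda.isPointSymmetry_fieldV hH hK (ψ j).2 hs,
      fun j l => GenToda.isPointSymmetry_fieldZ hH hK (φ l).2 (ψ j).2, fun v hv => ?_,
      GenToda.combination_eq_zero_iff ψ φ b⟩⟩
  obtain ⟨ξ, η, g, A, h, rfl⟩ := (GenToda.isPointSymmetry_iff hH hK v).1 hv
  obtain ⟨r, s, q, hr, hs, hq⟩ := h.exists_combination ψ φ hH hb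
  exact ⟨ξ, η, r, s, q, h.contDiff_x, h.contDiff_y, hr, hs, hq⟩
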